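/- Let $\mathbb R^3_1$ be $\mathbb R^3$ with the inner product $\langle x,y\rangle=-x_1y_1+x_2y_2+x_3y_3$. A smooth surface $f\colon M\to\mathbb R^3_1$ from a 2-manifold is \emph{timelike} if its first fundamental form $\mathrm I_f=\langle df,df\rangle$ is Lorentzian everywhere (in particular $f$ is an immersion, without singular points), and \emph{timelike minimal} if moreover the mean curvature $H=\frac12\operatorname{tr}S$ vanishes, $S$ being the shape operator. A point is \emph{flat} if $K=\det S=0$ there, \emph{umbilic} if $S$ is a multiple of the identity, and \emph{quasi-umbilic} if $S$ is not diagonalizable over $\mathbb C$. Let $\mathbb C'=\{x+jy: x,y\in\mathbb R\}$, $j^2=1$, be the paracomplex numbers, $e^{j\theta}=\cosh\theta+j\sinh\theta$. If a timelike minimal surface is written as $f=\operatorname{Re}\Phi$ with $\Phi\colon M\to(\mathbb C')^3$ paraholomorphic with respect to the paracomplex structure that the conformal class of $\mathrm I_f$ and a choice of orientation induce on $M$, its \emph{associated family} is $f_\theta=\operatorname{Re}(e^{j\theta}\Phi)$, $\theta\in\mathbb R$, and its \emph{conjugate surface} is $\hat f=\operatorname{Re}(j\Phi)$. (If $\Phi=\int{}^t(-(1+h^2),j(1-h^2),2h)\,\eta$,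 these are the surfaces with Weierstrass data $(h,e^{j\theta}\eta)$ and $(h,j\eta)$.) They depend on the choices only up to translations and, for the opposite orientation, $\theta\mapsto-\theta$ and $\hat f\mapsto-\hat f$. Surfaces $f_1\colon M_1\to\mathbb R^3_1$ and $f_2\colon M_2\to\mathbb R^3_1$ are \emph{isometric} (\emph{anti-isometric}) via a diffeomorphism $\sigma\colon M_1\to M_2$ if $\mathrm I_{f_1}=\sigma^*\mathrm I_{f_2}$ ($\mathrm I_{f_1}=-\sigma^*\mathrm I_{f_2}$), and \emph{congruent} via $\sigma$ if $f_1=T\circ f_2\circ\sigma$ for an isometry $T(x)=Ax+t$ of $\mathbb R^3_1$ with $A\in\mathrm O(1,2)$, $t\in\mathbb R^3_1$. **Theorem.** (1) There exist two flat timelike minimal surfaces in $\mathbb R^3_1$ that are isometric, but one of which is not congruent (via any diffeomorphism) to any member of the associated family of the other. Explicitly, on $\mathbb R^2$ with coordinates $(u,v)$ let $$p(u,v)=\tfrac{e^u}{2}\,{}^t(-2,\sqrt3,1)+{}^t(v,0,v),\qquad b(u,v)={}^t\!\left(-u-\tfrac34e^u,\;2\sqrt3\,e^{u/2},\;-u+\tfrac34e^u\right)+{}^t(v,0,v).$$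 Both are timelike minimal surfaces with $K\equiv0$ and first fundamental form $3e^u\,du\,dv$, so they are isometric via the identity; $p$ is totally umbilic and lies in a timelike plane; $b$ is totally quasi-umbilic and is a B-scroll (a ruled surface $\varphi(u)+vB(u)$ whose base curve $\varphi$ and director curve $B$ are lightlike, i.e. $\varphi'$ and $B$ are nowhere zero null vectors). The associated family of $p$ exists on $\mathbb R^2$, and $b$ is not congruent to any member of it. Let $f_1\colon M_1\to\mathbb R^3_1$ and $f_2\colon M_2\to\mathbb R^3_1$ be timelike minimal surfaces without flat points, with $M_1,M_2$ simply connected, and let $\sigma\colon M_1\to M_2$ be a diffeomorphism. (2) If $f_1$ and $f_2$ are isometric via $\sigma$, then the associated family $\{(f_2)_\theta\}_{\theta\in\mathbb R}$ of $f_2$ exists on $M_2$, and $f_1$ is congruent via $\sigma$ to some member of it. (3) If $f_1$ and $f_2$ are anti-isometric via $\sigma$, then the conjugate surface $\hat f_2$ of $f_2$ and its associated family $\{(\hat f_2)_\theta\}_{\theta\in\mathbb R}$ exist on $M_2$, and $f_1$ is congruent via $\sigma$ to some member of this family. -/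

import Mathlib

open scoped Manifold ContDiff Topology

noncomputable section

namespace TimelikeMinimal

/-! ### Lorentz--Minkowski space -/

/-- The vector space underlying the Lorentz--Minkowski space `ℝ³₁`. The metric of this space is
`lorentz` below; the (sup) norm carried by `Fin 3 → ℝ` only provides the usual topology and the
usual notion of smoothness. -/
abbrev Mink : Type := Fin 3 → ℝ

/-- The indefinite inner product `-x₁y₁ + x₂y₂ + x₃y₃`. -/
def lorentz (x y : Mink) : ℝ := -(x 0 * y 0) + x 1 * y 1 + x 2 * y 2

/-- `A` belongs to the indefinite orthogonal group `O(1,2)`. (Such a map is automatically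
bijective.) -/
def IsLorentzOrthogonal (A : Mink →ₗ[ℝ] Mink) : Prop :=
  ∀ x y, lorentz (A x) (A y) = lorentz x y

/-! ### Paracomplex numbers -/

/-- The paracomplex numbers `x + j y` with `j² = 1`. -/
abbrev ParaComplex : Type := QuadraticAlgebra ℝ 1 0

/-- The imaginary unit `j`. -/
def paraJ : ParaComplex := ⟨0, 1⟩

/-- `e^{jθ} = cosh θ + j sinh θ`. -/
def paraExp (θ : ℝ) : ParaComplex := ⟨Real.cosh θ, Real.sinh θ⟩

/-! ### Surfaces in `ℝ³₁` -/

/-- The parameter plane. -/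
abbrev Plane : Type := EuclideanSpace ℝ (Fin 2)

section Surface

variable {M : Type*} [TopologicalSpace M] [ChartedSpace Plane M]

/-- The differential of a map `M → ℝ³₁` at `p`. -/
def diff (f : M → Mink) (p : M) : TangentSpace (𝓡 2) p →ₗ[ℝ] Mink :=
  (mfderiv (𝓡 2) 𝓘(ℝ, Mink) f p).toLinearMap

/-- The first fundamental form `I_f = ⟨df, df⟩`. -/
def firstForm (f : M → Mink) (p : M) (X Y : TangentSpace (𝓡 2) p) : ℝ :=
  lorentz (diff f p X) (diff f p Y)

/-- A smooth surface is timelike if its first fundamental form is Lorentzian at every point; for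
a symmetric bilinear form on a two-dimensional space this means that it takes a negative and a
positive value. Such a surface is in particular an immersion. -/
def IsTimelike (f : M → Mink) : Prop :=
  ContMDiff (𝓡 2) 𝓘(ℝ, Mink) ∞ f ∧
    ∀ p : M, (∃ X, firstForm f p X X < 0) ∧ (∃ Y, 0 < firstForm f p Y Y)

/-- `S` is the shape operator of `f` at `p` with respect to a smooth unit normal field `ν` defined
near `p`, that is, `dν = -df ∘ S` at `p`. For a timelike surface it exists and is unique up to
the sign that comes from the choice of `ν` or `-ν`. -/
def IsShapeOperator (f : M → Mink) (p : M)
    (S : TangentSpace (𝓡 2) p →ₗ[ℝ] TangentSpace (𝓡 2) p) : Prop :=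
  ∃ ν : M → Mink, ContMDiffAt (𝓡 2) 𝓘(ℝ, Mink) ∞ ν p ∧
    (∀ᶠ q in 𝓝 p, lorentz (ν q) (ν q) = 1 ∧ ∀ X, lorentz (ν q) (diff f q X) = 0) ∧
    ∀ X, diff ν p X = -diff f p (S X)

/-- The Gaussian curvature `det S` of `f` at `p` is `K`. -/
def HasGaussCurvature (f : M → Mink) (p : M) (K : ℝ) : Prop :=
  ∃ S, IsShapeOperator f p S ∧ K = LinearMap.det S

/-- The mean curvature `(1/2) tr S` of `f` at `p` is `H` (up to the sign of the normal). -/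
def HasMeanCurvature (f : M → Mink) (p : M) (H : ℝ) : Prop :=
  ∃ S, IsShapeOperator f p S ∧ H = 1 / 2 * LinearMap.trace ℝ (TangentSpace (𝓡 2) p) S

/-- Timelike minimal surfaces: timelike surfaces with vanishing mean curvature. -/
def IsTimelikeMinimal (f : M → Mink) : Prop :=
  IsTimelike f ∧ ∀ p, HasMeanCurvature f p 0

/-- A flat point is a point where the Gaussian curvature vanishes. -/
def IsFlatPoint (f : M → Mink) (p : M) : Prop := HasGaussCurvature f p 0

/-- Umbilic point: the shape operator is a multiple of the identity. -/
def IsUmbilic (f : M → Mink) (p : M) : Prop :=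
  ∃ S, IsShapeOperator f p S ∧ ∃ c : ℝ, S = c • LinearMap.id

/-- Quasi-umbilic point: the shape operator is not diagonalizable over `ℂ`, i.e. there is no basis
of the complexified tangent plane that consists of eigenvectors of the complexified operator. -/
def IsQuasiUmbilic (f : M → Mink) (p : M) : Prop :=
  ∃ S, IsShapeOperator f p S ∧
    ¬ ∃ b : Module.Basis (Fin 2) ℂ (TensorProduct ℝ ℂ (TangentSpace (𝓡 2) p)),
        ∀ i, ∃ c : ℂ, S.baseChange ℂ (b i) = c • b i

/-! ### Paraholomorphic null curves, associated family, conjugate surface -/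

/-- The real part of a map into the paracomplex `3`-space. -/
def rePart (Φ : M → Fin 3 → ParaComplex) : M → Mink := fun p i => (Φ p i).re

/-- The imaginary part of a map into the paracomplex `3`-space. -/
def imPart (Φ : M → Fin 3 → ParaComplex) : M → Mink := fun p i => (Φ p i).im

/-- `J` is a paracomplex structure that turns `M`, with the conformal class of the Lorentzian
metric `I_f`, into a Lorentz surface: `J² = id` and `I_f(JX, JY) = -I_f(X, Y)`. In coordinates
with `I_f = λ (dx² - dy²)` it is `J ∂x = ∂y`, `J ∂y = ∂x`, or the negative of this, according
to the orientation. -/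
def IsParaComplexStructure (f : M → Mink)
    (J : ∀ p : M, TangentSpace (𝓡 2) p →ₗ[ℝ] TangentSpace (𝓡 2) p) : Prop :=
  ∀ p X, J p (J p X) = X ∧ ∀ Y, firstForm f p (J p X) (J p Y) = -firstForm f p X Y

/-- `Φ` is paraholomorphic for `J`: `Φ` is smooth and `dΦ(J X) = j dΦ(X)`. In coordinates
`z = x + j y` with `J ∂x = ∂y` this is the equation `∂Φ/∂z̄ = (1/2)(Φ_x - j Φ_y) = 0`. -/
def IsParaholomorphic (J : ∀ p : M, TangentSpace (𝓡 2) p →ₗ[ℝ] TangentSpace (𝓡 2) p)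
    (Φ : M → Fin 3 → ParaComplex) : Prop :=
  ContMDiff (𝓡 2) 𝓘(ℝ, Mink) ∞ (rePart Φ) ∧ ContMDiff (𝓡 2) 𝓘(ℝ, Mink) ∞ (imPart Φ) ∧
    ∀ p X, diff (rePart Φ) p (J p X) = diff (imPart Φ) p X ∧
      diff (imPart Φ) p (J p X) = diff (rePart Φ) p X

/-- `Φ` is a paraholomorphic (null) curve on the Lorentz surface `M` with `f = Re Φ`. It is unique
up to an imaginary constant and, according to the orientation of `M`, up to conjugation. (Smoothness
of `J` is automatic, since `df` is injective and `df ∘ J = d (Im Φ)`.) -/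
def IsParaholomorphicLift (f : M → Mink) (Φ : M → Fin 3 → ParaComplex) : Prop :=
  (∃ J, IsParaComplexStructure f J ∧ IsParaholomorphic J Φ) ∧ rePart Φ = f

/-- `F` is the associated family `f_θ = Re (e^{jθ} Φ)` of `f = Re Φ`. If
`Φ = ∫ (-(1 + h²), j (1 - h²), 2h) η`, then `e^{jθ} Φ` is given by the data `(h, e^{jθ} η)`. -/
def IsAssociatedFamily (f : M → Mink) (F : ℝ → M → Mink) : Prop :=
  ∃ Φ, IsParaholomorphicLift f Φ ∧ ∀ θ, F θ = rePart (paraExp θ • Φ)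

/-- `g` is the conjugate surface `Re (j Φ)` of `f = Re Φ`. If
`Φ = ∫ (-(1 + h²), j (1 - h²), 2h) η`, then `j Φ` is given by the data `(h, j η)`. -/
def IsConjugateSurface (f g : M → Mink) : Prop :=
  ∃ Φ, IsParaholomorphicLift f Φ ∧ g = rePart (paraJ • Φ)

/-! ### Isometric, anti-isometric and congruent surfaces -/

variable {N : Type*} [TopologicalSpace N] [ChartedSpace Plane N]

/-- The diffeomorphism `σ` is an isometry between the surfaces `f` and `g`: `I_f = σ^* I_g`. -/
def IsIsometry (σ : M ≃ₘ⟮𝓡 2, 𝓡 2⟯ N) (f : M → Mink) (g : N → Mink) : Prop :=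
  ∀ p X Y, firstForm f p X Y =
    firstForm g (σ p) (mfderiv (𝓡 2) (𝓡 2) σ p X) (mfderiv (𝓡 2) (𝓡 2) σ p Y)

/-- The diffeomorphism `σ` is an anti-isometry between `f` and `g`: `I_f = -σ^* I_g`. -/
def IsAntiIsometry (σ : M ≃ₘ⟮𝓡 2, 𝓡 2⟯ N) (f : M → Mink) (g : N → Mink) : Prop :=
  ∀ p X Y, firstForm f p X Y =
    -firstForm g (σ p) (mfderiv (𝓡 2) (𝓡 2) σ p X) (mfderiv (𝓡 2) (𝓡 2) σ p Y)

/-- With `M` and `N` identified by `σ`, the surfaces `f` and `g` agree up to an isometry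
`x ↦ A x + t` of `ℝ³₁`. -/
def CongruentVia (σ : M ≃ₘ⟮𝓡 2, 𝓡 2⟯ N) (f : M → Mink) (g : N → Mink) : Prop :=
  ∃ (A : Mink →ₗ[ℝ] Mink) (t : Mink), IsLorentzOrthogonal A ∧ ∀ p, f p = A (g (σ p)) + t

/-- Congruence of surfaces. -/
def Congruent (f : M → Mink) (g : N → Mink) : Prop :=
  ∃ σ : M ≃ₘ⟮𝓡 2, 𝓡 2⟯ N, CongruentVia σ f g

end Surface

/-! ### The two flat surfaces -/

/-- `f` lies in a timelike plane `⟨n, x⟩ = c`, `⟨n, n⟩ = 1`. -/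
def LiesInTimelikePlane (f : Plane → Mink) : Prop :=
  ∃ (n : Mink) (c : ℝ), lorentz n n = 1 ∧ ∀ z, lorentz n (f z) = c

/-- `f(u,v) = φ(u) + v B(u)` is a B-scroll: a ruled surface whose base curve `φ` and director
curve `B` are lightlike. -/
def IsBScroll (f : Plane → Mink) : Prop :=
  ∃ φ B : ℝ → Mink, ContDiff ℝ ∞ φ ∧ ContDiff ℝ ∞ B ∧
    (∀ u, deriv φ u ≠ 0 ∧ lorentz (deriv φ u) (deriv φ u) = 0) ∧
    (∀ u, B u ≠ 0 ∧ lorentz (B u) (B u) = 0) ∧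
    ∀ z : Plane, f z = φ (z 0) + z 1 • B (z 0)

/-- The surface `(-2, √3, 1) e^u / 2 + (v, 0, v)`. -/
def planeExample (z : Plane) : Mink :=
  ![-2 * Real.exp (z 0) / 2 + z 1,
    Real.sqrt 3 * Real.exp (z 0) / 2,
    Real.exp (z 0) / 2 + z 1]

/-- The surface `(-u - (3/4) e^u, 2 √3 e^{u/2}, -u + (3/4) e^u) + (v, 0, v)`. -/
def scrollExample (z : Plane) : Mink :=
  ![-z 0 - 3 / 4 * Real.exp (z 0) + z 1,
    2 * Real.sqrt 3 * Real.exp (z 0 / 2),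
    -z 0 + 3 / 4 * Real.exp (z 0) + z 1]

end TimelikeMinimal

end

/-!
Let `f` be a timelike minimal surface. The condition `tr S = 0` says that the vector-valued
one-form `ν × df`, with `ν` a unit normal, is closed (`exists_closed_normal`). Its local
primitives are the local conjugate surfaces of `f`; they are unique up to a sign and a constant,
so on a simply connected surface they glue to a global `Ψ` (`exists_global_section`, a lifting
argument for a covering space). Since `ν ×` is a paracomplex structure on the tangent planes,
`f + j Ψ` is a paraholomorphic curve with real part `f` (`exists_isLift`). This gives the existence of
the conjugate surface and of the associated family `cosh θ • f + sinh θ • Ψ`.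

For rigidity, the maps `f + Ψ` and `f - Ψ` are null curves, each depending on one null coordinate
only: `f + Ψ = a(u)` and `f - Ψ = b(v)`. A null vector without time component vanishes, so the
time components of the two curves may themselves be taken as coordinates (`exists_isNullChart`).
The metric determines exactly the inner products `⟨a'(u), b'(v)⟩`. If a second surface is
isometric to `f`, then its null curves in the same coordinates have the same inner products. As
`f` has no flat points, the directions `a'(u)` and `b'(v)` each take infinitely many values on the
conic of null directions (`IsNullChart.infinite_directions`); such a set spans `ℝ³₁`, so there is
a linear map that carries the first curves to the second, and a quadratic form vanishing on such a
set is a multiple of the Lorentz form, so the map is conformal. Scaling it to a Lorentz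
transformation leaves the factors `e^θ` and `e^{-θ}` on the two curves
(`exists_boost_of_lorentz_eq`), and this is what passing to the member `θ` of the associated
family does. The parameter and the motion are locally unique (`congruence_unique`), hence constant
on a connected surface (`exists_congruence`). If the paracomplex structures of the two surfaces
have opposite signs, one of them is replaced by its negative.

The conjugate surface has the same unit normals as `f` and the opposite first fundamental form, so
an anti-isometry to `f` is an isometry to the conjugate surface, to which rigidity applies.

Flatness is essential in the counterexample: both surfaces have the form `φ(u) + v B` with `B`
null, and their conjugate surfaces are `φ(u) - v B`. All members of the associated family of a
surface in a plane lie in parallel planes, while the scroll is not contained in any plane.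
-/

namespace TimelikeMinimal

/-! ### Linear algebra of Lorentz--Minkowski space -/

/-- The inner product `lorentz` as a bilinear form. -/
def lorentzForm : LinearMap.BilinForm ℝ Mink :=
  LinearMap.mk₂ ℝ lorentz
    (fun x y z => by simp only [lorentz, Pi.add_apply]; ring)
    (fun c x y => by simp only [lorentz, Pi.smul_apply, smul_eq_mul]; ring)
    (fun x y z => by simp only [lorentz, Pi.add_apply]; ring)
    (fun c x y => by simp only [lorentz, Pi.smul_apply, smul_eq_mul]; ring)

@[simp] lemma lorentzForm_apply (x y : Mink) : lorentzForm x y = lorentz x y := rfl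

lemma lorentz_comm (x y : Mink) : lorentz x y = lorentz y x := by
  simp only [lorentz]; ring

lemma lorentz_add_left (x y z : Mink) : lorentz (x + y) z = lorentz x z + lorentz y z := by
  simp only [lorentz, Pi.add_apply]; ring

lemma lorentz_add_right (x y z : Mink) : lorentz x (y + z) = lorentz x y + lorentz x z := by
  simp only [lorentz, Pi.add_apply]; ring

lemma lorentz_sub_left (x y z : Mink) : lorentz (x - y) z = lorentz x z - lorentz y z := by
  simp only [lorentz, Pi.sub_apply]; ring

lemma lorentz_sub_right (x y z : Mink) : lorentz x (y - z) = lorentz x y - lorentz x z := by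
  simp only [lorentz, Pi.sub_apply]; ring

lemma lorentz_neg_left (x y : Mink) : lorentz (-x) y = -lorentz x y := by
  simp only [lorentz, Pi.neg_apply]; ring

lemma lorentz_neg_right (x y : Mink) : lorentz x (-y) = -lorentz x y := by
  simp only [lorentz, Pi.neg_apply]; ring

lemma lorentz_smul_left (c : ℝ) (x y : Mink) : lorentz (c • x) y = c * lorentz x y := by
  simp only [lorentz, Pi.smul_apply, smul_eq_mul]; ring

lemma lorentz_smul_right (c : ℝ) (x y : Mink) : lorentz x (c • y) = c * lorentz x y := by
  simp only [lorentz, Pi.smul_apply, smul_eq_mul]; ring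

/-- The inner product is nondegenerate. -/
lemma eq_zero_of_forall_lorentz_eq_zero {x : Mink} (h : ∀ y, lorentz x y = 0) : x = 0 := by
  have h0 := h ![1, 0, 0]
  have h1 := h ![0, 1, 0]
  have h2 := h ![0, 0, 1]
  simp [lorentz] at h0 h1 h2
  ext i; fin_cases i <;> simp [h0, h1, h2]

lemma eq_zero_of_forall_mem_span {s : Set Mink} (hs : Submodule.span ℝ s = ⊤) {x : Mink}
    (h : ∀ y ∈ s, lorentz x y = 0) : x = 0 := by
  refine eq_zero_of_forall_lorentz_eq_zero fun y => ?_
  have hy : y ∈ Submodule.span ℝ s := hs ▸ Submodule.mem_top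
  have : Submodule.span ℝ s ≤ LinearMap.ker (lorentzForm x) :=
    Submodule.span_le.2 fun z hz => h z hz
  exact this hy

/-- A null vector whose time component vanishes is zero. -/
lemma eq_zero_of_null {x : Mink} (h : lorentz x x = 0) (h0 : x 0 = 0) : x = 0 := by
  simp only [lorentz, h0] at h
  have h1 : x 1 = 0 := by nlinarith [sq_nonneg (x 1), sq_nonneg (x 2)]
  have h2 : x 2 = 0 := by nlinarith [sq_nonneg (x 1), sq_nonneg (x 2)]
  ext i; fin_cases i <;> simp [h0, h1, h2]

/-- The cross product of `ℝ³₁`: `⟨x × y, z⟩ = det (x, y, z)`. -/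
def cross : Mink →ₗ[ℝ] Mink →ₗ[ℝ] Mink :=
  LinearMap.mk₂ ℝ
    (fun x y => ![-(x 1 * y 2 - x 2 * y 1), x 2 * y 0 - x 0 * y 2, x 0 * y 1 - x 1 * y 0])
    (fun x y z => by ext i; fin_cases i <;> simp <;> ring)
    (fun c x y => by ext i; fin_cases i <;> simp <;> ring)
    (fun x y z => by ext i; fin_cases i <;> simp <;> ring)
    (fun c x y => by ext i; fin_cases i <;> simp <;> ring)

lemma cross_apply (x y : Mink) : cross x y =
    ![-(x 1 * y 2 - x 2 * y 1), x 2 * y 0 - x 0 * y 2, x 0 * y 1 - x 1 * y 0] := rfl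

lemma cross_self (x : Mink) : cross x x = 0 := by
  ext i; fin_cases i <;> simp [cross_apply] <;> ring

lemma cross_anticomm (x y : Mink) : cross x y = -cross y x := by
  ext i; fin_cases i <;> simp [cross_apply] <;> ring

lemma lorentz_cross_self (x y : Mink) : lorentz x (cross x y) = 0 := by
  simp [lorentz, cross_apply]; ring

/-- Multiplication by a unit normal reverses the sign of the inner product of tangent vectors. -/
lemma lorentz_cross_cross {n a b : Mink} (hn : lorentz n n = 1) (ha : lorentz n a = 0)
    (hb : lorentz n b = 0) : lorentz (cross n a) (cross n b) = -lorentz a b := by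
  have : lorentz (cross n a) (cross n b) =
      -(lorentz n n * lorentz a b - lorentz n b * lorentz n a) := by
    simp [lorentz, cross_apply]; ring
  rw [this, hn, ha, hb]; ring

/-- Multiplication by a unit normal is an involution of the tangent plane. -/
lemma cross_cross {n a : Mink} (hn : lorentz n n = 1) (ha : lorentz n a = 0) :
    cross n (cross n a) = a := by
  have : cross n (cross n a) = lorentz n n • a - lorentz n a • n := by
    ext i; fin_cases i <;> simp [lorentz, cross_apply] <;> ring
  rw [this, hn, ha]; simp

/-! ### Null directions and conformal maps -/

open Polynomial in
/-- A quadratic form that vanishes at infinitely many points of the conic of null directions is a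
multiple of the Lorentz form: in the rational parametrization of the conic it is a polynomial of
degree at most four. -/
lemma exists_smul_of_infinite_null {B : LinearMap.BilinForm ℝ Mink} (hB : ∀ x y, B x y = B y x)
    {S : Set Mink} (hS : S.Infinite) (h0 : ∀ w ∈ S, w 0 = 1) (hn : ∀ w ∈ S, lorentz w w = 0)
    (h : ∀ w ∈ S, B w w = 0) : ∃ c : ℝ, ∀ x y, B x y = c * lorentz x y := by
  set e : Fin 3 → Mink := fun i => Pi.single i 1
  have hexp : ∀ x : Mink, x = x 0 • e 0 + x 1 • e 1 + x 2 • e 2 := by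
    intro x; ext i; fin_cases i <;> simp [e]
  have hBxy : ∀ x y, B x y = x 0 * y 0 * B (e 0) (e 0) + x 1 * y 1 * B (e 1) (e 1)
      + x 2 * y 2 * B (e 2) (e 2) + (x 0 * y 1 + x 1 * y 0) * B (e 0) (e 1)
      + (x 0 * y 2 + x 2 * y 0) * B (e 0) (e 2) + (x 1 * y 2 + x 2 * y 1) * B (e 1) (e 2) := by
    intro x y
    conv_lhs => rw [hexp x, hexp y]
    simp only [map_add, map_smul, LinearMap.add_apply, LinearMap.smul_apply, smul_eq_mul]
    rw [hB (e 1) (e 0), hB (e 2) (e 0), hB (e 2) (e 1)]; ring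
  generalize B (e 0) (e 0) = a at hBxy
  generalize B (e 1) (e 1) = b at hBxy
  generalize B (e 2) (e 2) = c at hBxy
  generalize B (e 0) (e 1) = d at hBxy
  generalize B (e 0) (e 2) = f at hBxy
  generalize B (e 1) (e 2) = g at hBxy
  set p : ℝ[X] := C (a + b + 2 * d) + C (4 * f + 4 * g) * X + C (2 * a - 2 * b + 4 * c) * X ^ 2
    + C (4 * f - 4 * g) * X ^ 3 + C (a + b - 2 * d) * X ^ 4 with hp
  -- The rational parametrization `s ↦ (1 + s², 1 - s², 2s)` misses exactly one null direction.
  set S' := S \ {![1, -1, 0]}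
  have hS' : S'.Infinite := hS.sdiff (Set.finite_singleton _)
  have hne : ∀ w ∈ S', 1 + w 1 ≠ 0 := by
    rintro w ⟨hw, hw'⟩ h1
    refine hw' ?_
    have e0 := h0 w hw
    have e1 : w 1 = -1 := by linarith
    have := hn w hw
    simp only [lorentz, e0, e1] at this
    have e2 : w 2 = 0 := by nlinarith
    simp only [Set.mem_singleton_iff]
    ext i; fin_cases i <;> simp [e0, e1, e2]
  have hsq : ∀ w ∈ S, w 2 ^ 2 = 1 - w 1 ^ 2 := by
    intro w hw
    have := hn w hw
    simp only [lorentz, h0 w hw] at this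
    linarith
  have hinj : Set.InjOn (fun w : Mink => w 2 / (1 + w 1)) S' := by
    intro w hw z hz hwz
    have hw1 := hne w hw
    have hz1 := hne z hz
    simp only at hwz
    have key : w 2 ^ 2 * (1 + z 1) ^ 2 = z 2 ^ 2 * (1 + w 1) ^ 2 := by
      field_simp at hwz
      rw [← mul_pow, ← mul_pow, hwz, mul_comm]
    rw [hsq w hw.1, hsq z hz.1] at key
    have k1 : w 1 = z 1 := by
      have : (1 + w 1) * (1 + z 1) * (w 1 - z 1) = 0 := by linear_combination -key / 2
      rcases mul_eq_zero.1 this with h | h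
      · exact absurd h (mul_ne_zero hw1 hz1)
      · linarith
    rw [k1] at hwz
    have k2 : w 2 = z 2 := by field_simp at hwz; exact hwz
    ext i; fin_cases i <;> simp [h0 w hw.1, h0 z hz.1, k1, k2]
  have hroot : ∀ w ∈ S', p.IsRoot (w 2 / (1 + w 1)) := by
    intro w hw
    have hw1 := hne w hw
    have e2 := hsq w hw.1
    have hq := h w hw.1
    rw [hBxy, h0 w hw.1] at hq
    set s := w 2 / (1 + w 1) with hs
    have es : w 2 = s * (1 + w 1) := by rw [hs]; field_simp
    have es2 : s ^ 2 * (1 + w 1) = 1 - w 1 := by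
      rw [es] at e2
      have : (1 + w 1) * (s ^ 2 * (1 + w 1) - (1 - w 1)) = 0 := by linear_combination e2
      rcases mul_eq_zero.1 this with h | h
      · exact absurd h hw1
      · linarith
    have ew : w 1 = (1 - s ^ 2) / (1 + s ^ 2) := by
      have : (1 + s ^ 2) ≠ 0 := by positivity
      field_simp; linear_combination es2
    have hpos : (1 + s ^ 2) ≠ 0 := by positivity
    have es' : w 2 = 2 * s / (1 + s ^ 2) := by rw [es, ew]; field_simp; ring
    rw [es', ew] at hq
    field_simp at hq
    simp only [IsRoot, hp, eval_add, eval_mul, eval_C, eval_X, eval_pow]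
    linear_combination hq
  have hp0 : p = 0 := Polynomial.eq_zero_of_infinite_isRoot _
    ((hS'.image hinj).mono (by rintro _ ⟨w, hw, rfl⟩; exact hroot w hw))
  have c0 : p.coeff 0 = 0 := by rw [hp0]; simp
  have c1 : p.coeff 1 = 0 := by rw [hp0]; simp
  have c2 : p.coeff 2 = 0 := by rw [hp0]; simp
  have c3 : p.coeff 3 = 0 := by rw [hp0]; simp
  have c4 : p.coeff 4 = 0 := by rw [hp0]; simp
  simp only [hp, coeff_add, coeff_C_mul, coeff_C, coeff_X, coeff_X_pow] at c0 c1 c2 c3 c4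
  norm_num at c0 c1 c2 c3 c4
  refine ⟨b, fun x y => ?_⟩
  have ea : a = -b := by linarith
  have ed : d = 0 := by linarith
  have ef : f = 0 := by linarith
  have eg : g = 0 := by linarith
  have ec : c = b := by linarith
  rw [hBxy, ea, ed, ef, eg, ec, lorentz]; ring

/-- Infinitely many null directions span `ℝ³₁`. -/
lemma span_eq_top_of_infinite_null {S : Set Mink} (hS : S.Infinite) (h0 : ∀ w ∈ S, w 0 = 1)
    (hn : ∀ w ∈ S, lorentz w w = 0) : Submodule.span ℝ S = ⊤ := by
  by_contra hne
  obtain ⟨l, hl, hlS⟩ := Submodule.exists_le_ker_of_lt_top _ (lt_top_iff_ne_top.2 hne)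
  obtain ⟨c, hc⟩ := exists_smul_of_infinite_null (B := (LinearMap.mul ℝ ℝ).compl₁₂ l l)
    (fun x y => by simp [mul_comm]) hS h0 hn
    (fun w hw => by
      have : l w = 0 := hlS (Submodule.subset_span hw)
      simp [this])
  simp only [LinearMap.compl₁₂_apply, LinearMap.mul_apply'] at hc
  have hnull : ∀ w, lorentz w w = 0 → l w = 0 := fun w hw => by
    have := hc w w
    rw [hw] at this
    nlinarith
  refine hl (LinearMap.ext fun x => ?_)
  have h1 := hnull ![1, 1, 0] (by simp [lorentz])
  have h2 := hnull ![1, -1, 0] (by simp [lorentz])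
  have h3 := hnull ![1, 0, 1] (by simp [lorentz])
  have hx : x = ((x 0 + x 1 - x 2) / 2) • ![1, 1, 0] + ((x 0 - x 1 - x 2) / 2) • ![1, -1, 0]
      + x 2 • ![1, 0, 1] := by
    ext i; fin_cases i <;> simp <;> ring
  rw [hx, map_add, map_add, map_smul, map_smul, map_smul, h1, h2, h3]; simp

/-- A conformal factor of a nonzero linear map of `ℝ³₁` is positive, by taking determinants. -/
lemma pos_of_conformal {A : Mink →ₗ[ℝ] Mink} {c : ℝ} (hc : c ≠ 0)
    (h : ∀ x y, lorentz (A x) (A y) = c * lorentz x y) : 0 < c := by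
  set e : Fin 3 → Mink := fun i => Pi.single i 1
  have h00 := h (e 0) (e 0)
  have h11 := h (e 1) (e 1)
  have h22 := h (e 2) (e 2)
  have h01 := h (e 0) (e 1)
  have h02 := h (e 0) (e 2)
  have h12 := h (e 1) (e 2)
  generalize A (e 0) = x at *
  generalize A (e 1) = y at *
  generalize A (e 2) = z at *
  simp [lorentz, e] at h00 h11 h22 h01 h02 h12
  have hdet : lorentz (cross x y) z ^ 2 = c ^ 3 := by
    have : lorentz (cross x y) z ^ 2 = -(lorentz x x * (lorentz y y * lorentz z z - lorentz y z ^ 2)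
        - lorentz x y * (lorentz x y * lorentz z z - lorentz y z * lorentz x z)
        + lorentz x z * (lorentz x y * lorentz y z - lorentz y y * lorentz x z)) := by
      simp [lorentz, cross_apply]; ring
    rw [this]; simp only [lorentz, h00, h11, h22, h01, h02, h12]; ring
  by_contra hneg
  have hlt : c < 0 := lt_of_le_of_ne (not_lt.1 hneg) hc
  have : c ^ 3 < 0 := by
    have := mul_pos (neg_pos.2 hlt) (mul_pos (neg_pos.2 hlt) (neg_pos.2 hlt))
    nlinarith
  nlinarith [sq_nonneg (lorentz (cross x y) z)]

/-- The algebraic form of the rigidity theorem: two pairs of null curves with the same mutual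
inner products agree up to a Lorentz transformation and a boost `(e^θ, e^{-θ})`, as soon as the
first pair is nondegenerate. The linear map `a i ↦ a' i` is well defined because the `b' j`
separate points; it is conformal because it preserves infinitely many null directions. -/
theorem exists_boost_of_lorentz_eq {I J : Type*} {a a' : I → Mink} {b b' : J → Mink}
    (ha0 : ∀ i, a i 0 = 1) (ha : ∀ i, lorentz (a i) (a i) = 0) (hinf : (Set.range a).Infinite)
    (hb : Submodule.span ℝ (Set.range b) = ⊤) (ha' : ∀ i, lorentz (a' i) (a' i) = 0)
    (h : ∀ i j, lorentz (a' i) (b' j) = lorentz (a i) (b j)) :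
    ∃ (θ : ℝ) (A : Mink →ₗ[ℝ] Mink), IsLorentzOrthogonal A ∧
      (∀ i, a' i = Real.exp θ • A (a i)) ∧ ∀ j, b' j = Real.exp (-θ) • A (b j) := by
  have haspan : Submodule.span ℝ (Set.range a) = ⊤ := span_eq_top_of_infinite_null hinf
    (by rintro _ ⟨i, rfl⟩; exact ha0 i) (by rintro _ ⟨i, rfl⟩; exact ha i)
  set T : Mink →ₗ[ℝ] (J → ℝ) := LinearMap.pi fun j => lorentzForm.flip (b j)
  set T' : Mink →ₗ[ℝ] (J → ℝ) := LinearMap.pi fun j => lorentzForm.flip (b' j)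
  have hTT : ∀ i, T' (a' i) = T (a i) := fun i => funext fun j => h i j
  have hTinj : Function.Injective T := by
    refine (injective_iff_map_eq_zero _).2 fun x hx => eq_zero_of_forall_mem_span hb ?_
    rintro _ ⟨j, rfl⟩
    exact congrFun hx j
  have hrange : (Submodule.span ℝ (Set.range a')).map T' = LinearMap.range T := by
    rw [LinearMap.range_eq_map, ← haspan, Submodule.map_span, Submodule.map_span, ← Set.range_comp,
      ← Set.range_comp]
    congr 2; exact funext hTT
  have hdim : Module.finrank ℝ (LinearMap.range T) = 3 := by
    rw [LinearMap.finrank_range_of_inj hTinj]; simp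
  have haspan' : Submodule.span ℝ (Set.range a') = ⊤ := by
    refine Submodule.eq_top_of_finrank_eq (le_antisymm (Submodule.finrank_le _) ?_)
    have := Submodule.finrank_map_le T' (Submodule.span ℝ (Set.range a'))
    rw [hrange, hdim] at this
    simpa using this
  have hTinj' : Function.Injective T' := by
    rw [haspan', ← LinearMap.range_eq_map] at hrange
    have h1 := LinearMap.finrank_range_add_finrank_ker T'
    rw [hrange, hdim] at h1
    simp only [Module.finrank_fin_fun] at h1
    exact LinearMap.ker_eq_bot.1 (Submodule.finrank_eq_zero.1 (by omega))
  obtain ⟨R, hR⟩ := T'.exists_leftInverse_of_injective (LinearMap.ker_eq_bot.2 hTinj')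
  set A₁ : Mink →ₗ[ℝ] Mink := R ∘ₗ T
  have hA₁ : ∀ i, A₁ (a i) = a' i := fun i => by
    change R (T (a i)) = a' i
    rw [← hTT]; exact LinearMap.congr_fun hR (a' i)
  obtain ⟨c, hc⟩ := exists_smul_of_infinite_null (B := lorentzForm.compl₁₂ A₁ A₁)
    (fun x y => by simp [lorentz_comm]) hinf
    (by rintro _ ⟨i, rfl⟩; exact ha0 i) (by rintro _ ⟨i, rfl⟩; exact ha i)
    (by rintro _ ⟨i, rfl⟩; simp [hA₁, ha'])
  simp only [LinearMap.compl₁₂_apply, lorentzForm_apply] at hc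
  have hsurj : Function.Surjective A₁ := by
    rw [← LinearMap.range_eq_top, eq_top_iff, ← haspan', Submodule.span_le]
    rintro _ ⟨i, rfl⟩
    exact ⟨_, hA₁ i⟩
  have hc0 : c ≠ 0 := by
    rintro rfl
    obtain ⟨x, hx⟩ := hsurj ![0, 1, 0]
    have := hc x x
    rw [hx] at this
    simp [lorentz] at this
  have hcpos := pos_of_conformal hc0 hc
  have hexp : Real.exp (Real.log c / 2) * Real.exp (Real.log c / 2) = c := by
    rw [← Real.exp_add, add_halves, Real.exp_log hcpos]
  refine ⟨Real.log c / 2, Real.exp (-(Real.log c / 2)) • A₁, ?_, ?_, ?_⟩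
  · intro x y
    simp only [LinearMap.smul_apply, lorentz_smul_left, lorentz_smul_right, hc, Real.exp_neg]
    rw [← mul_assoc, ← mul_assoc, ← mul_inv, hexp, inv_mul_cancel₀ hc0, one_mul]
  · intro i
    rw [LinearMap.smul_apply, smul_smul, ← Real.exp_add, add_neg_cancel, Real.exp_zero, one_smul,
      hA₁]
  · intro j
    rw [LinearMap.smul_apply, smul_smul, ← Real.exp_add, ← neg_add, add_halves, Real.exp_neg,
      Real.exp_log hcpos]
    obtain ⟨w, hw⟩ := hsurj (b' j)
    have : c • w - b j = 0 := by
      refine eq_zero_of_forall_mem_span haspan ?_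
      rintro _ ⟨i, rfl⟩
      rw [lorentz_sub_left, lorentz_smul_left, lorentz_comm w, ← hc, hw, hA₁, h, lorentz_comm,
        sub_self]
    rw [← sub_eq_zero.1 this, map_smul, smul_smul, inv_mul_cancel₀ hc0, one_smul, hw]

/-! ### Gluing local sections over a simply connected space -/

/-- On a simply connected, locally path connected space, local sections that are determined by one
value and can be continued into each other glue to a global section. The section `s i c` lives on
`U i`; the parameter `c` is the fibre coordinate of a covering space whose sections are the global
sections that are sought, and the identity map of the base lifts to this covering space. -/
theorem exists_global_section {M F Y : Type*} [TopologicalSpace M] [SimplyConnectedSpace M]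
    [LocallyPathConnectedSpace M] [Nonempty F] (U : M → Set M) (hU : ∀ i, IsOpen (U i))
    (hmem : ∀ x, x ∈ U x) (s : M → F → M → Y)
    (hs : ∀ i j c x, x ∈ U i → x ∈ U j → ∃ c', ∀ᶠ y in 𝓝 x, s i c y = s j c' y)
    (hinj : ∀ i x, x ∈ U i → Function.Injective fun c => s i c x) :
    ∃ S : M → Y, ∀ x, ∃ c, ∀ᶠ y in 𝓝 x, S y = s x c y := by
  classical
  let _ : TopologicalSpace F := ⊥
  have _ : DiscreteTopology F := ⟨rfl⟩
  choose! t ht using hs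
  have hval : ∀ i j x c, x ∈ U i → x ∈ U j → s j (t i j c x) x = s i c x :=
    fun i j x c hi hj => (ht i j c x hi hj).self_of_nhds.symm
  let Z : FiberBundleCore M M F :=
    { baseSet := U
      isOpen_baseSet := hU
      indexAt := id
      mem_baseSet_at := hmem
      coordChange := fun i j x c => t i j c x
      coordChange_self := fun i x hx c => hinj i x hx (hval i i x c hx hx)
      continuousOn_coordChange := by
        rintro i j ⟨x, c⟩ ⟨⟨hi, hj⟩, -⟩
        have hev : ∀ᶠ y in 𝓝 x, t i j c y = t i j c x := by
          filter_upwards [ht i j c x hi hj, (hU i).mem_nhds hi, (hU j).mem_nhds hj]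
            with y hy hyi hyj
          exact hinj j y hyj ((hval i j y c hyi hyj).trans hy)
        refine ContinuousAt.continuousWithinAt ?_
        refine continuousAt_const.congr (f := fun _ => t i j c x) ?_
        rw [nhds_prod_eq, nhds_discrete F]
        filter_upwards [Filter.prod_mem_prod hev (Filter.mem_pure.2 (Set.mem_singleton c))]
        rintro ⟨y, d⟩ ⟨hy, rfl⟩
        exact hy.symm
      coordChange_comp := by
        rintro i j k x ⟨⟨hi, hj⟩, hk⟩ c
        refine hinj k x hk ?_
        simp only
        rw [hval j k x _ hj hk, hval i j x _ hi hj, hval i k x _ hi hk] }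
  have hcov : IsCoveringMap (Bundle.TotalSpace.proj : Bundle.TotalSpace F Z.Fiber → M) :=
    FiberBundle.isCoveringMap (F := F) (E := Z.Fiber)
  obtain ⟨x₀⟩ : Nonempty M := inferInstance
  obtain ⟨c₀⟩ : Nonempty F := inferInstance
  obtain ⟨σ, ⟨-, hσ⟩, -⟩ := hcov.existsUnique_continuousMap_lifts (ContinuousMap.id M) x₀
    ⟨x₀, c₀⟩ rfl
  have hproj : ∀ y, (σ y).proj = y := fun y => congrFun hσ y
  have hmain : ∀ x, ∃ c, ∀ᶠ y in 𝓝 x, t (σ y).proj x (σ y).2 (σ y).proj = c := by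
    intro x
    have hc : ContinuousAt (fun y => ((Z.localTriv x) (σ y)).2) x := by
      have h1 : ContinuousAt (Z.localTriv x) (σ x) :=
        (Z.localTriv x).continuousAt ((Z.localTriv x).mem_source.2 (by
          change (σ x).proj ∈ U x
          rw [hproj]; exact hmem x))
      exact (continuousAt_snd.comp h1).comp σ.continuous.continuousAt
    have hopen : {((Z.localTriv x) (σ x)).2} ∈ 𝓝 ((Z.localTriv x) (σ x)).2 := by
      rw [nhds_discrete F]; exact Set.mem_singleton _
    exact ⟨((Z.localTriv x) (σ x)).2, hc hopen⟩
  refine ⟨fun y => s (σ y).proj (σ y).2 y, fun x => ?_⟩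
  obtain ⟨c, hc⟩ := hmain x
  refine ⟨c, ?_⟩
  filter_upwards [hc, (hU x).mem_nhds (hmem x)] with y hy hyx
  rw [← hy]
  have := hval (σ y).proj x y (σ y).2 (by rw [hproj]; exact hmem y) hyx
  rw [← this]
  congr 2
  exact (hproj y).symm

/-! ### Tangent planes and unit normals -/

section TangentPlane

variable {E : Type*} [AddCommGroup E] [Module ℝ E]

/-- A linear map from a plane whose image contains both a timelike and a spacelike vector is
injective: on a line the inner product does not change sign. -/
lemma injective_of_timelike (hE : Module.finrank ℝ E = 2) {D : E →ₗ[ℝ] Mink} {X Y : E}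
    (hX : lorentz (D X) (D X) < 0) (hY : 0 < lorentz (D Y) (D Y)) : Function.Injective D := by
  have : FiniteDimensional ℝ E := FiniteDimensional.of_finrank_pos (by omega)
  by_contra hD
  have hker : Module.finrank ℝ (LinearMap.ker D) ≠ 0 := fun h =>
    hD (LinearMap.ker_eq_bot.1 (Submodule.finrank_eq_zero.1 h))
  have hdim : Module.finrank ℝ (LinearMap.range D) ≤ 1 := by
    have := LinearMap.finrank_range_add_finrank_ker D
    omega
  have hX0 : (⟨D X, X, rfl⟩ : LinearMap.range D) ≠ 0 := fun h => by
    have h' : D X = 0 := congrArg Subtype.val h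
    rw [h'] at hX
    simp [lorentz] at hX
  obtain ⟨v, hv⟩ := finrank_le_one_iff.1 hdim
  obtain ⟨c, hc⟩ := hv ⟨D X, X, rfl⟩
  obtain ⟨d, hd⟩ := hv ⟨D Y, Y, rfl⟩
  have hc' : D X = c • (v : Mink) := (congrArg Subtype.val hc).symm
  have hd' : D Y = d • (v : Mink) := (congrArg Subtype.val hd).symm
  rw [hc', lorentz_smul_left, lorentz_smul_right] at hX
  rw [hd', lorentz_smul_left, lorentz_smul_right] at hY
  rcases le_or_gt 0 (lorentz (v : Mink) v) with h | h
  · nlinarith [mul_nonneg (mul_self_nonneg c) h]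
  · nlinarith [mul_nonneg (mul_self_nonneg d) (neg_pos.2 h).le]

variable {D : E →ₗ[ℝ] Mink} {n : Mink}

/-- The orthogonal decomposition of `ℝ³₁` into a tangent plane and its normal line. -/
lemma exists_eq_add_normal (hE : Module.finrank ℝ E = 2) (hD : Function.Injective D)
    (hn : lorentz n n = 1) (hnD : ∀ X, lorentz n (D X) = 0) (y : Mink) :
    ∃ X, y = D X + lorentz n y • n := by
  have : FiniteDimensional ℝ E := FiniteDimensional.of_finrank_pos (by omega)
  have hinf : LinearMap.range D ⊓ Submodule.span ℝ {n} = ⊥ := by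
    rw [eq_bot_iff]
    rintro z ⟨⟨X, rfl⟩, hz⟩
    obtain ⟨c, hc⟩ := Submodule.mem_span_singleton.1 hz
    have h1 : lorentz n (D X) = c := by rw [← hc, lorentz_smul_right, hn, mul_one]
    rw [hnD] at h1
    rw [Submodule.mem_bot, ← hc, ← h1, zero_smul]
  have hn0 : n ≠ 0 := by
    rintro rfl
    simp [lorentz] at hn
  have hsup : LinearMap.range D ⊔ Submodule.span ℝ {n} = ⊤ := by
    refine Submodule.eq_top_of_finrank_eq ?_
    have h1 := Submodule.finrank_sup_add_finrank_inf_eq (LinearMap.range D) (Submodule.span ℝ {n})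
    rw [hinf, finrank_bot, LinearMap.finrank_range_of_inj hD, finrank_span_singleton hn0, hE] at h1
    simpa using h1
  have hy : y ∈ LinearMap.range D ⊔ Submodule.span ℝ {n} := hsup ▸ Submodule.mem_top
  obtain ⟨_, ⟨X, rfl⟩, z, hz, rfl⟩ := Submodule.mem_sup.1 hy
  obtain ⟨c, rfl⟩ := Submodule.mem_span_singleton.1 hz
  refine ⟨X, ?_⟩
  rw [lorentz_add_right, hnD, lorentz_smul_right, hn, zero_add, mul_one]

lemma eq_zero_of_orthogonal (hE : Module.finrank ℝ E = 2) (hD : Function.Injective D)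
    (hn : lorentz n n = 1) (hnD : ∀ X, lorentz n (D X) = 0) {y : Mink} (hy : lorentz n y = 0)
    (hyD : ∀ X, lorentz y (D X) = 0) : y = 0 := by
  refine eq_zero_of_forall_lorentz_eq_zero fun z => ?_
  obtain ⟨X, hX⟩ := exists_eq_add_normal hE hD hn hnD z
  rw [hX, lorentz_add_right, hyD, lorentz_smul_right, lorentz_comm y, hy, mul_zero, add_zero]

/-- Unit normals of a timelike plane are unique up to sign. -/
lemma unit_normal_unique (hE : Module.finrank ℝ E = 2) (hD : Function.Injective D)
    (hn : lorentz n n = 1) (hnD : ∀ X, lorentz n (D X) = 0) {n' : Mink} (hn' : lorentz n' n' = 1)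
    (hnD' : ∀ X, lorentz n' (D X) = 0) :
    n' = lorentz n n' • n ∧ lorentz n n' ^ 2 = 1 := by
  have h : n' - lorentz n n' • n = 0 := by
    refine eq_zero_of_orthogonal hE hD hn hnD ?_ fun X => ?_
    · rw [lorentz_sub_right, lorentz_smul_right, hn, mul_one, sub_self]
    · rw [lorentz_sub_left, lorentz_smul_left, hnD, hnD', mul_zero, sub_self]
  have h' := sub_eq_zero.1 h
  refine ⟨h', ?_⟩
  rw [h', lorentz_smul_left, lorentz_smul_right, hn, mul_one] at hn'
  rw [sq]; exact hn'

/-- An alternating bilinear map on a plane satisfies `ω(SX, Y) + ω(X, SY) = tr S · ω(X, Y)`; for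
`tr S = 0` this says that `ω(SX, Y)` is symmetric. -/
lemma cross_symm_of_trace_eq_zero (hE : Module.finrank ℝ E = 2) {S : E →ₗ[ℝ] E}
    (hS : LinearMap.trace ℝ E S = 0) (X Y : E) :
    cross (D (S X)) (D Y) = cross (D (S Y)) (D X) := by
  have : FiniteDimensional ℝ E := FiniteDimensional.of_finrank_pos (by omega)
  let b := Module.finBasisOfFinrankEq ℝ E hE
  rw [LinearMap.trace_eq_matrix_trace ℝ b, Matrix.trace_fin_two] at hS
  have hrep : ∀ Z, Z = b.repr Z 0 • b 0 + b.repr Z 1 • b 1 := fun Z => by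
    conv_lhs => rw [← b.sum_repr Z, Fin.sum_univ_two]
  have h0 := hrep (S (b 0))
  have h1 := hrep (S (b 1))
  simp only [LinearMap.toMatrix_apply] at hS
  generalize b.repr (S (b 0)) 0 = p at *
  generalize b.repr (S (b 0)) 1 = q at *
  generalize b.repr (S (b 1)) 0 = r at *
  generalize b.repr (S (b 1)) 1 = s at *
  obtain rfl : s = -p := by linarith
  rw [hrep X, hrep Y]
  simp only [map_add, map_smul, h0, h1, LinearMap.add_apply, LinearMap.smul_apply, cross_self,
    cross_anticomm (D (b 1)) (D (b 0))]
  module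

end TangentPlane

/-! ### Differentials of maps into `ℝ³₁` -/

section Calculus

variable {M : Type*} [TopologicalSpace M] [ChartedSpace Plane M]
  {N : Type*} [TopologicalSpace N] [ChartedSpace Plane N]

lemma finrank_tangentSpace (p : M) : Module.finrank ℝ (TangentSpace (𝓡 2) p) = 2 :=
  finrank_euclideanSpace_fin

lemma diff_comp {f : N → Mink} {h : M → N} {p : M}
    (hf : MDifferentiableAt (𝓡 2) 𝓘(ℝ, Mink) f (h p))
    (hh : MDifferentiableAt (𝓡 2) (𝓡 2) h p) (X : TangentSpace (𝓡 2) p) :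
    diff (f ∘ h) p X = diff f (h p) (mfderiv (𝓡 2) (𝓡 2) h p X) :=
  mfderiv_comp_apply p hf hh X

lemma diff_congr {f g : M → Mink} {p : M} (h : f =ᶠ[𝓝 p] g) : diff f p = diff g p := by
  simp only [diff, h.mfderiv_eq]; rfl

lemma diff_eq_fderiv (f : Plane → Mink) (z X : Plane) : diff f z X = fderiv ℝ f z X := by
  simp only [diff, mfderiv_eq_fderiv]; rfl

lemma diff_add {f g : M → Mink} {p : M} (hf : MDifferentiableAt (𝓡 2) 𝓘(ℝ, Mink) f p)
    (hg : MDifferentiableAt (𝓡 2) 𝓘(ℝ, Mink) g p) (X : TangentSpace (𝓡 2) p) :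
    diff (f + g) p X = diff f p X + diff g p X := by
  have := (hf.hasMFDerivAt.add hg.hasMFDerivAt).mfderiv
  simp only [diff, this]; rfl

lemma diff_affine {f : M → Mink} {p : M} (hf : MDifferentiableAt (𝓡 2) 𝓘(ℝ, Mink) f p)
    (A : Mink →ₗ[ℝ] Mink) (t : Mink) (X : TangentSpace (𝓡 2) p) :
    diff (fun q => A (f q) + t) p X = A (diff f p X) := by
  let A' : Mink →L[ℝ] Mink := LinearMap.toContinuousLinearMap A
  have hA : HasMFDerivAt 𝓘(ℝ, Mink) 𝓘(ℝ, Mink) (fun y => A y + t) (f p) A' :=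
    (A'.hasFDerivAt.add_const t).hasMFDerivAt
  have := (hA.comp p hf.hasMFDerivAt).mfderiv
  have h2 : diff (fun q => A (f q) + t) p =
    (mfderiv (𝓡 2) 𝓘(ℝ, Mink) ((fun y => A y + t) ∘ f) p).toLinearMap := rfl
  rw [h2, this]; rfl

lemma diff_smul {f : M → Mink} {p : M} (hf : MDifferentiableAt (𝓡 2) 𝓘(ℝ, Mink) f p)
    (c : ℝ) (X : TangentSpace (𝓡 2) p) : diff (c • f) p X = c • diff f p X := by
  have := diff_affine hf (c • LinearMap.id) 0 X
  simpa using! this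

lemma contMDiffAt_affine {f : M → Mink} {p : M} (hf : ContMDiffAt (𝓡 2) 𝓘(ℝ, Mink) ∞ f p)
    (A : Mink →ₗ[ℝ] Mink) (t : Mink) :
    ContMDiffAt (𝓡 2) 𝓘(ℝ, Mink) ∞ (fun q => A (f q) + t) p := by
  let A' : Mink →L[ℝ] Mink := LinearMap.toContinuousLinearMap A
  have hA : ContMDiff 𝓘(ℝ, Mink) 𝓘(ℝ, Mink) ∞ fun y => A y + t :=
    (A'.contDiff.add contDiff_const).contMDiff
  exact hA.contMDiffAt.comp p hf

lemma contMDiffAt_smul {f : M → Mink} {p : M} (hf : ContMDiffAt (𝓡 2) 𝓘(ℝ, Mink) ∞ f p)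
    (c : ℝ) : ContMDiffAt (𝓡 2) 𝓘(ℝ, Mink) ∞ (c • f) p := by
  have := contMDiffAt_affine hf (c • LinearMap.id) 0
  simpa using! this

end Calculus

/-! ### Local existence of conjugate surfaces -/

section LocalExistence

variable {M : Type*} [TopologicalSpace M] [ChartedSpace Plane M]

/-- `ν q` is a unit normal vector of the surface `f` at `q`. -/
def IsUnitNormalAt (f ν : M → Mink) (q : M) : Prop :=
  lorentz (ν q) (ν q) = 1 ∧ ∀ X, lorentz (ν q) (diff f q X) = 0

/-- At `q`, the map `ν` is a smooth unit normal of `f`, and `Ψ` is a smooth map whose differential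
is that of `f` followed by the rotation `ν ×` of the tangent plane. Since `ν ×` is one of the two
paracomplex structures of the tangent plane, `Ψ` is the imaginary part of a paraholomorphic map
with real part `f`. -/
structure IsConjugateAt (f ν Ψ : M → Mink) (q : M) : Prop where
  smooth_normal : ContMDiffAt (𝓡 2) 𝓘(ℝ, Mink) ∞ ν q
  smooth_conj : ContMDiffAt (𝓡 2) 𝓘(ℝ, Mink) ∞ Ψ q
  normal : IsUnitNormalAt f ν q
  diff_eq : ∀ X, diff Ψ q X = cross (ν q) (diff f q X)

lemma IsTimelike.injective_diff {f : M → Mink} (hf : IsTimelike f) (p : M) :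
    Function.Injective (diff f p) := by
  obtain ⟨⟨X, hX⟩, ⟨Y, hY⟩⟩ := hf.2 p
  exact injective_of_timelike (finrank_tangentSpace p) hX hY

lemma continuousAt_lorentz {T : Type*} [TopologicalSpace T] {a b : T → Mink} {q : T}
    (ha : ContinuousAt a q) (hb : ContinuousAt b q) :
    ContinuousAt (fun x => lorentz (a x) (b x)) q := by
  have ha' := fun i => (continuous_apply i).continuousAt.comp ha
  have hb' := fun i => (continuous_apply i).continuousAt.comp hb
  exact (((ha' 0).mul (hb' 0)).neg.add ((ha' 1).mul (hb' 1))).add ((ha' 2).mul (hb' 2))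

/-- Two continuous unit normal fields agree locally up to a constant sign. -/
lemma eventually_eq_smul_normal {f ν ν' : M → Mink} (hf : IsTimelike f) {q : M}
    (hν : ContinuousAt ν q) (hν' : ContinuousAt ν' q) (hn : ∀ᶠ x in 𝓝 q, IsUnitNormalAt f ν x)
    (hn' : ∀ᶠ x in 𝓝 q, IsUnitNormalAt f ν' x) :
    ∃ ε : ℝ, ε ^ 2 = 1 ∧ ν' =ᶠ[𝓝 q] ε • ν := by
  have key : ∀ x, IsUnitNormalAt f ν x → IsUnitNormalAt f ν' x →
      ν' x = lorentz (ν x) (ν' x) • ν x ∧ lorentz (ν x) (ν' x) ^ 2 = 1 := fun x h h' =>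
    unit_normal_unique (finrank_tangentSpace x) (hf.injective_diff x) h.1 h.2 h'.1 h'.2
  have hq := (key q hn.self_of_nhds hn'.self_of_nhds).2
  have hc := continuousAt_lorentz hν hν'
  refine ⟨lorentz (ν q) (ν' q), hq, ?_⟩
  have hclose := Metric.continuousAt_iff'.1 hc 1 one_pos
  filter_upwards [hclose, hn, hn'] with x hx h h'
  obtain ⟨h1, h2⟩ := key x h h'
  rw [Real.dist_eq, abs_lt] at hx
  have : lorentz (ν x) (ν' x) = lorentz (ν q) (ν' q) := by
    rcases eq_or_eq_neg_of_sq_eq_sq _ _ (h2.trans hq.symm) with h3 | h3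
    · exact h3
    · nlinarith
  rw [this] at h1
  exact h1

variable [IsManifold (𝓡 2) ∞ M]

lemma contMDiffAt_chart {p x : M} (hx : x ∈ (chartAt Plane p).source) :
    ContMDiffAt (𝓡 2) (𝓡 2) ∞ (chartAt Plane p) x :=
  contMDiffAt_of_mem_maximalAtlas (IsManifold.chart_mem_maximalAtlas p) hx

lemma contMDiffAt_chart_symm {p : M} {z : Plane} (hz : z ∈ (chartAt Plane p).target) :
    ContMDiffAt (𝓡 2) (𝓡 2) ∞ (chartAt Plane p).symm z :=
  contMDiffAt_symm_of_mem_maximalAtlas (IsManifold.chart_mem_maximalAtlas p) hz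

lemma diff_eq_fderiv_chart {f : M → Mink} {p x : M} (hx : x ∈ (chartAt Plane p).source)
    (hf : MDifferentiableAt (𝓡 2) 𝓘(ℝ, Mink) f x) (X : TangentSpace (𝓡 2) x) :
    diff f x X = fderiv ℝ (f ∘ (chartAt Plane p).symm) (chartAt Plane p x)
      (mfderiv (𝓡 2) (𝓡 2) (chartAt Plane p) x X) := by
  set e := chartAt Plane p
  have hz := e.map_source hx
  have h1 : MDifferentiableAt (𝓡 2) 𝓘(ℝ, Mink) (f ∘ e.symm) (e x) := by
    refine MDifferentiableAt.comp (e x) (g := f) ?_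
      ((contMDiffAt_chart_symm hz).mdifferentiableAt (by simp))
    rw [e.left_inv hx]; exact hf
  have h2 : f =ᶠ[𝓝 x] (f ∘ e.symm) ∘ e := by
    filter_upwards [e.open_source.mem_nhds hx] with y hy
    simp [e.left_inv hy]
  rw [diff_congr h2]
  exact (diff_comp h1 ((contMDiffAt_chart hx).mdifferentiableAt (by simp)) X).trans
    (diff_eq_fderiv _ _ _)

/-- A map with vanishing differential is locally constant. -/
lemma eventually_eq_of_diff_eq_zero {f : M → Mink} {p : M}
    (hf : ∀ᶠ x in 𝓝 p, MDifferentiableAt (𝓡 2) 𝓘(ℝ, Mink) f x ∧ ∀ X, diff f x X = 0) :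
    ∀ᶠ x in 𝓝 p, f x = f p := by
  set e := chartAt Plane p
  have hp : p ∈ e.source := mem_chart_source Plane p
  have hnhds : e.target ∩ e.symm ⁻¹' {x | MDifferentiableAt (𝓡 2) 𝓘(ℝ, Mink) f x ∧
      ∀ X, diff f x X = 0} ∈ 𝓝 (e p) := by
    refine Filter.inter_mem (e.open_target.mem_nhds (e.map_source hp)) ?_
    refine (e.continuousAt_symm (e.map_source hp)).preimage_mem_nhds ?_
    rw [e.left_inv hp]; exact hf
  obtain ⟨r, hr, hball⟩ := Metric.mem_nhds_iff.1 hnhds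
  have hd : ∀ z ∈ Metric.ball (e p) r, MDifferentiableAt (𝓡 2) 𝓘(ℝ, Mink) (f ∘ e.symm) z :=
    fun z hz => MDifferentiableAt.comp z (hball hz).2.1
      ((contMDiffAt_chart_symm (hball hz).1).mdifferentiableAt (by simp))
  have h0 : Set.EqOn (fderiv ℝ (f ∘ e.symm)) 0 (Metric.ball (e p) r) := by
    intro z hz
    ext1 X
    exact (diff_eq_fderiv _ z X).symm.trans ((diff_comp (hball hz).2.1
      ((contMDiffAt_chart_symm (hball hz).1).mdifferentiableAt (by simp)) X).trans
      ((hball hz).2.2 _))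
  have hconst := fun z (hz : z ∈ Metric.ball (e p) r) =>
    Metric.isOpen_ball.is_const_of_fderiv_eq_zero (convex_ball (e p) r).isPreconnected
      (fun z hz => ((hd z hz).differentiableAt).differentiableWithinAt) h0 hz
      (Metric.mem_ball_self hr)
  filter_upwards [e.open_source.mem_nhds hp,
    (e.continuousAt hp).preimage_mem_nhds (Metric.ball_mem_nhds _ hr)] with x hx hxr
  have := hconst _ hxr
  simpa [e.left_inv hx, e.left_inv hp] using this

/-- Near every point, a unit normal of a minimal timelike surface satisfies the integrability
condition of the one-form `ν × df`, whose exterior derivative is `tr S` times the area form. -/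
lemma exists_closed_normal {f : M → Mink} (hf : IsTimelikeMinimal f) (p : M) :
    ∃ ν : M → Mink, ∀ᶠ q in 𝓝 p, ContMDiffAt (𝓡 2) 𝓘(ℝ, Mink) ∞ ν q ∧ IsUnitNormalAt f ν q ∧
      ∀ X Y, cross (diff ν q X) (diff f q Y) = cross (diff ν q Y) (diff f q X) := by
  obtain ⟨-, ⟨ν, hν, hn, -⟩, -⟩ := hf.2 p
  refine ⟨ν, ?_⟩
  have hcont : ∀ᶠ q in 𝓝 p, ContinuousAt ν q := by
    have := (contMDiffAt_iff_contMDiffAt_nhds (n := 1) (by simp)).1 (hν.of_le (by simp))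
    exact this.mono fun q hq => hq.continuousAt
  filter_upwards [hcont, hn.eventually_nhds] with q hq hnq
  obtain ⟨S, ⟨ν', hν', hn', hS⟩, htr⟩ := hf.2 q
  obtain ⟨ε, -, hε⟩ := eventually_eq_smul_normal hf.1 hν'.continuousAt hq hn' hnq
  refine ⟨?_, hnq.self_of_nhds, fun X Y => ?_⟩
  · exact (contMDiffAt_smul hν' ε).congr_of_eventuallyEq hε
  · have hd : ∀ X, diff ν q X = -(ε • diff f q (S X)) := fun X => by
      rw [diff_congr hε]
      exact (diff_smul (hν'.mdifferentiableAt (by simp)) ε X).trans (by rw [hS, smul_neg])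
    have := cross_symm_of_trace_eq_zero (D := diff f q) (finrank_tangentSpace q) (S := S)
      (by linarith) X Y
    simp only [hd, map_neg, map_smul, LinearMap.neg_apply, LinearMap.smul_apply, this]

/-- `cross` as a continuous bilinear map. -/
noncomputable def crossL : Mink →L[ℝ] Mink →L[ℝ] Mink :=
  LinearMap.toContinuousLinearMap
    ((LinearMap.toContinuousLinearMap : (Mink →ₗ[ℝ] Mink) ≃ₗ[ℝ] _).toLinearMap ∘ₗ cross)

/-- A minimal timelike surface locally has a conjugate surface, by the Poincaré lemma. -/
lemma exists_isConjugateAt {f : M → Mink} (hf : IsTimelikeMinimal f) (p : M) :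
    ∃ ν Ψ : M → Mink, ∀ᶠ x in 𝓝 p, IsConjugateAt f ν Ψ x := by
  obtain ⟨ν, hν⟩ := exists_closed_normal hf p
  set e := chartAt Plane p
  have hp : p ∈ e.source := mem_chart_source Plane p
  have hnhds : e.target ∩ e.symm ⁻¹' {q | ContMDiffAt (𝓡 2) 𝓘(ℝ, Mink) ∞ ν q ∧
      IsUnitNormalAt f ν q ∧
      ∀ X Y, cross (diff ν q X) (diff f q Y) = cross (diff ν q Y) (diff f q X)} ∈ 𝓝 (e p) := by
    refine Filter.inter_mem (e.open_target.mem_nhds (e.map_source hp)) ?_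
    refine (e.continuousAt_symm (e.map_source hp)).preimage_mem_nhds ?_
    rw [e.left_inv hp]; exact hν
  obtain ⟨r, hr, hball⟩ := Metric.mem_nhds_iff.1 hnhds
  set B := Metric.ball (e p) r
  have hκ : ∀ z ∈ B, ContMDiffAt (𝓡 2) (𝓡 2) ∞ e.symm z :=
    fun z hz => contMDiffAt_chart_symm (hball hz).1
  have hfs : ∀ z ∈ B, ContDiffAt ℝ ∞ (f ∘ e.symm) z := fun z hz =>
    (hf.1.1.contMDiffAt.comp z (hκ z hz)).contDiffAt
  have hνs : ∀ z ∈ B, ContDiffAt ℝ ∞ (ν ∘ e.symm) z := fun z hz =>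
    ((hball hz).2.1.comp z (hκ z hz)).contDiffAt
  have hfd : ∀ z ∈ B, ContDiffAt ℝ ∞ (fderiv ℝ (f ∘ e.symm)) z := fun z hz =>
    (hfs z hz).fderiv_right (by simp)
  set η : Plane → Plane →L[ℝ] Mink := fun z =>
    (crossL ((ν ∘ e.symm) z)).comp (fderiv ℝ (f ∘ e.symm) z) with hη
  have hηs : ∀ z ∈ B, ContDiffAt ℝ ∞ η z := fun z hz =>
    (crossL.contDiff.contDiffAt.comp z (hνs z hz)).clm_comp (hfd z hz)
  have hηd : ∀ z ∈ B, ∀ X Y, fderiv ℝ η z X Y = cross ((ν ∘ e.symm) z)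
        (fderiv ℝ (fderiv ℝ (f ∘ e.symm)) z X Y)
      + cross (fderiv ℝ (ν ∘ e.symm) z X) (fderiv ℝ (f ∘ e.symm) z Y) := by
    intro z hz X Y
    have h1 : HasFDerivAt (fun z => crossL ((ν ∘ e.symm) z))
        (crossL.comp (fderiv ℝ (ν ∘ e.symm) z)) z :=
      crossL.hasFDerivAt.comp z ((hνs z hz).differentiableAt (by simp)).hasFDerivAt
    have h2 := h1.clm_comp ((hfd z hz).differentiableAt (by simp)).hasFDerivAt
    rw [hη, h2.fderiv]; rfl
  have hclosed : ∀ z ∈ B, ∀ X Y, fderiv ℝ η z X Y = fderiv ℝ η z Y X := by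
    intro z hz X Y
    have hκz := (hκ z hz).mdifferentiableAt (by simp)
    rw [hηd z hz, hηd z hz, ((hfs z hz).isSymmSndFDerivAt
      (by rw [minSmoothness_of_isRCLikeNormedField]; exact ENat.LEInfty.out)).eq X Y]
    have hν' : ∀ X, fderiv ℝ (ν ∘ e.symm) z X =
        diff ν (e.symm z) (mfderiv (𝓡 2) (𝓡 2) e.symm z X) :=
      fun X => (diff_eq_fderiv _ z X).symm.trans
        (diff_comp ((hball hz).2.1.mdifferentiableAt (by simp)) hκz X)
    have hf' : ∀ X, fderiv ℝ (f ∘ e.symm) z X =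
        diff f (e.symm z) (mfderiv (𝓡 2) (𝓡 2) e.symm z X) :=
      fun X => (diff_eq_fderiv _ z X).symm.trans
        (diff_comp (hf.1.1.contMDiffAt.mdifferentiableAt (by simp)) hκz X)
    rw [hν', hν', hf', hf', (hball hz).2.2.2]
  obtain ⟨Ψ, hΨ⟩ := (convex_ball (e p) r).exists_forall_hasFDerivAt_of_fderiv_symmetric
    Metric.isOpen_ball
    (fun z hz => ((hηs z hz).differentiableAt (by simp)).differentiableWithinAt) hclosed
  have hΨs : ContDiffOn ℝ ∞ Ψ B := by
    refine (contDiffOn_infty_iff_fderiv_of_isOpen Metric.isOpen_ball).2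
      ⟨fun z hz => (hΨ z hz).differentiableAt.differentiableWithinAt, ?_⟩
    exact ContDiffOn.congr (fun z hz => (hηs z hz).contDiffWithinAt) fun z hz => (hΨ z hz).fderiv
  refine ⟨ν, Ψ ∘ e, ?_⟩
  filter_upwards [hν, e.open_source.mem_nhds hp,
    (e.continuousAt hp).preimage_mem_nhds (Metric.ball_mem_nhds _ hr)] with x hνx hx hxr
  have hex := contMDiffAt_chart (p := p) hx
  have hΨx : ContMDiffAt (𝓡 2) 𝓘(ℝ, Mink) ∞ Ψ (e x) :=
    (hΨs.contDiffAt (Metric.isOpen_ball.mem_nhds hxr)).contMDiffAt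
  refine ⟨hνx.1, hΨx.comp x hex, hνx.2.1, fun X => ?_⟩
  have h1 := (diff_comp (hΨx.mdifferentiableAt (by simp)) (hex.mdifferentiableAt (by simp)) X).trans
    (diff_eq_fderiv _ _ _)
  rw [h1, (hΨ _ hxr).fderiv,
    diff_eq_fderiv_chart hx (hf.1.1.contMDiffAt.mdifferentiableAt (by simp))]
  change cross (ν (e.symm (e x))) _ = _
  rw [e.left_inv hx]
  rfl

end LocalExistence

/-! ### Global existence of conjugate surfaces -/

section GlobalExistence

variable {M : Type*} [TopologicalSpace M] [ChartedSpace Plane M]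

lemma IsConjugateAt.congr_smul {f ν Ψ ν' Ψ' : M → Mink} {q : M} (h : IsConjugateAt f ν Ψ q) {ε : ℝ}
    (hε : ε ^ 2 = 1) {c : Mink} (hν : ∀ᶠ x in 𝓝 q, ν' x = ε • ν x)
    (hΨ : ∀ᶠ x in 𝓝 q, Ψ' x = ε • Ψ x + c) : IsConjugateAt f ν' Ψ' q := by
  have hνq := hν.self_of_nhds
  refine ⟨(contMDiffAt_smul h.smooth_normal ε).congr_of_eventuallyEq hν,
    (contMDiffAt_affine h.smooth_conj (ε • LinearMap.id) c).congr_of_eventuallyEq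
      (hΨ.mono fun x hx => hx),
    ⟨?_, fun X => ?_⟩, fun X => ?_⟩
  · rw [hνq, lorentz_smul_left, lorentz_smul_right, h.normal.1, mul_one, ← sq, hε]
  · rw [hνq, lorentz_smul_left, h.normal.2, mul_zero]
  · rw [diff_congr (g := fun x => (ε • LinearMap.id (R := ℝ)) (Ψ x) + c) hΨ, hνq]
    refine (diff_affine (h.smooth_conj.mdifferentiableAt (by simp)) _ _ X).trans ?_
    rw [h.diff_eq, map_smul]; rfl

variable [IsManifold (𝓡 2) ∞ M]

/-- Local conjugate surfaces are unique up to a sign, which comes from the choice of the unit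
normal, and an additive constant. -/
lemma eventually_conjugate_eq {f ν Ψ ν' Ψ' : M → Mink} (hf : IsTimelike f) {q : M}
    (h : ∀ᶠ x in 𝓝 q, IsConjugateAt f ν Ψ x) (h' : ∀ᶠ x in 𝓝 q, IsConjugateAt f ν' Ψ' x) :
    ∃ (ε : ℝ) (c : Mink), ε ^ 2 = 1 ∧ ∀ᶠ x in 𝓝 q, ν' x = ε • ν x ∧ Ψ' x = ε • Ψ x + c := by
  obtain ⟨ε, hε, hν⟩ := eventually_eq_smul_normal hf h.self_of_nhds.smooth_normal.continuousAt
    h'.self_of_nhds.smooth_normal.continuousAt (h.mono fun _ hx => hx.normal)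
    (h'.mono fun _ hx => hx.normal)
  have hd : ∀ᶠ x in 𝓝 q, MDifferentiableAt (𝓡 2) 𝓘(ℝ, Mink) (Ψ' + (-ε) • Ψ) x ∧
      ∀ X, diff (Ψ' + (-ε) • Ψ) x X = 0 := by
    filter_upwards [h, h', hν] with x hx hx' hνx
    have h1 := hx'.smooth_conj.mdifferentiableAt (by simp)
    have h2 := hx.smooth_conj.mdifferentiableAt (by simp)
    have h3 : MDifferentiableAt (𝓡 2) 𝓘(ℝ, Mink) ((-ε) • Ψ) x :=
      (contMDiffAt_smul hx.smooth_conj (-ε)).mdifferentiableAt (by simp)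
    refine ⟨h1.add h3, fun X => ?_⟩
    rw [diff_add h1 h3, diff_smul h2, hx.diff_eq, hx'.diff_eq, hνx, Pi.smul_apply, map_smul,
      LinearMap.smul_apply, neg_smul, add_neg_cancel]
  refine ⟨ε, (Ψ' + (-ε) • Ψ) q, hε, ?_⟩
  filter_upwards [hν, eventually_eq_of_diff_eq_zero hd] with x hx hx'
  refine ⟨hx, ?_⟩
  rw [← hx', Pi.add_apply, Pi.smul_apply, neg_smul]; abel

/-- A minimal timelike surface on a simply connected manifold has a global unit normal and a global
conjugate surface. -/
theorem exists_forall_isConjugateAt [SimplyConnectedSpace M] {f : M → Mink}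
    (hf : IsTimelikeMinimal f) : ∃ ν Ψ : M → Mink, ∀ x, IsConjugateAt f ν Ψ x := by
  have : LocallyPathConnectedSpace M := ChartedSpace.locallyPathConnectedSpace Plane M
  choose ν Ψ hνΨ using fun i : M => exists_isConjugateAt hf i
  have hU : ∀ i x, x ∈ interior {x | IsConjugateAt f (ν i) (Ψ i) x} →
      ∀ᶠ y in 𝓝 x, IsConjugateAt f (ν i) (Ψ i) y := fun i x hx => mem_interior_iff_mem_nhds.1 hx
  have : Nonempty ({ε : ℝ // ε ^ 2 = 1} × Mink) := ⟨⟨⟨1, by simp⟩, 0⟩⟩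
  obtain ⟨S, hS⟩ := exists_global_section (F := {ε : ℝ // ε ^ 2 = 1} × Mink)
    (fun i => interior {x | IsConjugateAt f (ν i) (Ψ i) x}) (fun i => isOpen_interior)
    (fun i => mem_interior_iff_mem_nhds.2 (hνΨ i))
    (fun i c x => ((c.1 : ℝ) • ν i x, (c.1 : ℝ) • Ψ i x + c.2))
    (by
      rintro i j ⟨⟨ε, hε⟩, c⟩ x hi hj
      obtain ⟨δ, d, hδ, h⟩ := eventually_conjugate_eq hf.1 (hU j x hj) (hU i x hi)
      refine ⟨⟨⟨ε * δ, by rw [mul_pow, hε, hδ, mul_one]⟩, ε • d + c⟩, ?_⟩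
      filter_upwards [h] with y hy
      rw [hy.1, hy.2]
      simp only [smul_smul, smul_add, add_assoc])
    (by
      rintro i x hi ⟨⟨ε, hε⟩, c⟩ ⟨⟨δ, hδ⟩, d⟩ h
      simp only [Prod.mk.injEq] at h
      have hn := (hU i x hi).self_of_nhds.normal.1
      have hεδ : ε = δ := by
        have := congrArg (lorentz (ν i x)) h.1
        simpa [lorentz_smul_right, hn] using this
      subst hεδ
      simpa using h.2)
  refine ⟨fun x => (S x).1, fun x => (S x).2, fun x => ?_⟩
  obtain ⟨⟨⟨ε, hε⟩, c⟩, h⟩ := hS x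
  refine (hνΨ x).self_of_nhds.congr_smul hε (c := c) ?_ ?_
  · filter_upwards [h] with y hy
    rw [hy]
  · filter_upwards [h] with y hy
    rw [hy]

end GlobalExistence

/-! ### Paraholomorphic lifts -/

section Lift

variable {M : Type*} [TopologicalSpace M] [ChartedSpace Plane M]

/-- `f + j Ψ` is a paraholomorphic curve with respect to the paracomplex structure `J` of the
surface `f`: the content of `IsParaholomorphicLift` in terms of real and imaginary parts. -/
structure IsLift (f Ψ : M → Mink)
    (J : ∀ p : M, TangentSpace (𝓡 2) p →ₗ[ℝ] TangentSpace (𝓡 2) p) : Prop where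
  smooth : ContMDiff (𝓡 2) 𝓘(ℝ, Mink) ∞ f
  smooth_im : ContMDiff (𝓡 2) 𝓘(ℝ, Mink) ∞ Ψ
  structure_re : IsParaComplexStructure f J
  diff_J : ∀ p X, diff f p (J p X) = diff Ψ p X
  diff_im_J : ∀ p X, diff Ψ p (J p X) = diff f p X

lemma IsParaholomorphicLift.exists_isLift {f : M → Mink} {Φ : M → Fin 3 → ParaComplex}
    (h : IsParaholomorphicLift f Φ) : ∃ J, IsLift f (imPart Φ) J := by
  obtain ⟨⟨J, hJ, h1, h2, h3⟩, rfl⟩ := h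
  exact ⟨J, h1, h2, hJ, fun p X => (h3 p X).1, fun p X => (h3 p X).2⟩

lemma IsLift.isParaholomorphicLift {f Ψ : M → Mink}
    {J : ∀ p : M, TangentSpace (𝓡 2) p →ₗ[ℝ] TangentSpace (𝓡 2) p} (h : IsLift f Ψ J) :
    IsParaholomorphicLift f fun p i => ⟨f p i, Ψ p i⟩ :=
  ⟨⟨J, h.structure_re, h.smooth, h.smooth_im, fun p X => ⟨h.diff_J p X, h.diff_im_J p X⟩⟩, rfl⟩

lemma rePart_paraExp_smul {M : Type*} (Φ : M → Fin 3 → ParaComplex) (θ : ℝ) :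
    rePart (paraExp θ • Φ) = Real.cosh θ • rePart Φ + Real.sinh θ • imPart Φ := by
  funext p; funext i
  simp [rePart, imPart, paraExp]

lemma rePart_paraJ_smul {M : Type*} (Φ : M → Fin 3 → ParaComplex) :
    rePart (paraJ • Φ) = imPart Φ := by
  funext p; funext i
  simp [rePart, imPart, paraJ]

variable {f Ψ : M → Mink} {J : ∀ p : M, TangentSpace (𝓡 2) p →ₗ[ℝ] TangentSpace (𝓡 2) p}

lemma IsLift.firstForm_im (h : IsLift f Ψ J) (p : M) (X Y : TangentSpace (𝓡 2) p) :
    firstForm Ψ p X Y = -firstForm f p X Y := by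
  rw [← (h.structure_re p X).2 Y]
  simp only [firstForm, h.diff_J]

/-- The paraholomorphic curve `j (f + j Ψ)` of the conjugate surface. -/
lemma IsLift.conj (h : IsLift f Ψ J) : IsLift Ψ f J :=
  ⟨h.smooth_im, h.smooth, fun p X => ⟨(h.structure_re p X).1, fun Y => by
    rw [h.firstForm_im, h.firstForm_im, (h.structure_re p X).2]⟩, h.diff_im_J, h.diff_J⟩

lemma IsLift.mdifferentiableAt (h : IsLift f Ψ J) (p : M) :
    MDifferentiableAt (𝓡 2) 𝓘(ℝ, Mink) f p :=
  h.smooth.contMDiffAt.mdifferentiableAt (by simp)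

lemma IsLift.neg (h : IsLift f Ψ J) : IsLift f (-Ψ) (fun p => -J p) := by
  have hneg : ∀ p X, diff (-Ψ) p X = -diff Ψ p X := fun p X => by
    have := diff_smul (h.conj.mdifferentiableAt p) (-1) X
    simpa using! this
  refine ⟨h.smooth, fun p => ?_, fun p X => ⟨?_, fun Y => ?_⟩, fun p X => ?_, fun p X => ?_⟩
  · have := contMDiffAt_smul (h.smooth_im p) (-1)
    simpa using! this
  · simp [(h.structure_re p X).1]
  · have := (h.structure_re p X).2 Y
    simp only [firstForm, LinearMap.neg_apply, map_neg, lorentz_neg_left, lorentz_neg_right,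
      neg_neg] at this ⊢
    exact this
  · rw [LinearMap.neg_apply, map_neg, h.diff_J, hneg]
  · rw [hneg, LinearMap.neg_apply, map_neg, h.diff_im_J, neg_neg]

lemma IsLift.isTimelike_im (h : IsLift f Ψ J) (hf : IsTimelike f) : IsTimelike Ψ := by
  refine ⟨h.smooth_im, fun p => ?_⟩
  obtain ⟨⟨X, hX⟩, ⟨Y, hY⟩⟩ := hf.2 p
  exact ⟨⟨Y, by rw [h.firstForm_im]; linarith⟩, ⟨X, by rw [h.firstForm_im]; linarith⟩⟩

/-- A minimal timelike surface on a simply connected manifold is the real part of a paraholomorphic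
curve. -/
theorem exists_isLift [IsManifold (𝓡 2) ∞ M] [SimplyConnectedSpace M] (hf : IsTimelikeMinimal f) :
    ∃ Ψ J, IsLift f Ψ J := by
  obtain ⟨ν, Ψ, h⟩ := exists_forall_isConjugateAt hf
  have hinj := fun p => hf.1.injective_diff p
  choose L hL using fun p => (diff f p).exists_leftInverse_of_injective
    (LinearMap.ker_eq_bot.2 (hinj p))
  have hJ : ∀ p X, diff f p (L p (cross (ν p) (diff f p X))) = cross (ν p) (diff f p X) := by
    intro p X
    obtain ⟨Y, hY⟩ := exists_eq_add_normal (finrank_tangentSpace p) (hinj p) (h p).normal.1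
      (h p).normal.2 (cross (ν p) (diff f p X))
    rw [lorentz_cross_self, zero_smul, add_zero] at hY
    rw [hY]
    congr 1
    exact LinearMap.congr_fun (hL p) Y
  have hcc : ∀ p X, cross (ν p) (cross (ν p) (diff f p X)) = diff f p X := fun p X =>
    cross_cross (h p).normal.1 ((h p).normal.2 X)
  refine ⟨Ψ, fun p => L p ∘ₗ cross (ν p) ∘ₗ diff f p, hf.1.1, fun p => (h p).smooth_conj,
    fun p X => ⟨hinj p ?_, fun Y => ?_⟩, fun p X => ?_, fun p X => ?_⟩
  · simp only [LinearMap.comp_apply, hJ, hcc]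
    exact congrArg (diff f p) (LinearMap.congr_fun (hL p) X)
  · simp only [LinearMap.comp_apply, firstForm, hJ]
    exact lorentz_cross_cross (h p).normal.1 ((h p).normal.2 X) ((h p).normal.2 Y)
  · simp only [LinearMap.comp_apply, hJ, (h p).diff_eq]
  · simp only [LinearMap.comp_apply, (h p).diff_eq, hJ, hcc]

end Lift

/-! ### Null directions of a paraholomorphic lift -/

section Null

variable {M : Type*} [TopologicalSpace M] [ChartedSpace Plane M]

/-- A strong form of non-flatness that does not mention the shape operator: near `p` there is a
smooth unit normal whose differential at `p` is injective. It is shared by a surface and its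
conjugate surface, which have the same unit normals. -/
def IsNonflatAt (f : M → Mink) (p : M) : Prop :=
  ∃ ν : M → Mink, ContMDiffAt (𝓡 2) 𝓘(ℝ, Mink) ∞ ν p ∧ (∀ᶠ q in 𝓝 p, IsUnitNormalAt f ν q) ∧
    Function.Injective (diff ν p)

lemma isNonflatAt_of_not_isFlatPoint {f : M → Mink} (hf : IsTimelikeMinimal f) {p : M}
    (hp : ¬ IsFlatPoint f p) : IsNonflatAt f p := by
  obtain ⟨S, ⟨ν, hν, hn, hS⟩, -⟩ := hf.2 p
  refine ⟨ν, hν, hn, ?_⟩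
  have hdet : LinearMap.det S ≠ 0 := fun h => hp ⟨S, ⟨ν, hν, hn, hS⟩, h.symm⟩
  have : FiniteDimensional ℝ (TangentSpace (𝓡 2) p) :=
    FiniteDimensional.of_finrank_pos (by rw [finrank_tangentSpace]; norm_num)
  have hSinj : Function.Injective S := by
    rw [← LinearMap.ker_eq_bot]
    by_contra hker
    exact hdet (LinearMap.det_eq_zero_iff_ker_ne_bot.2 hker)
  refine (injective_iff_map_eq_zero _).2 fun X hX => ?_
  rw [hS, neg_eq_zero] at hX
  exact (injective_iff_map_eq_zero _).1 hSinj _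
    ((injective_iff_map_eq_zero _).1 (hf.1.injective_diff p) _ hX)

variable {f Ψ : M → Mink} {J : ∀ p : M, TangentSpace (𝓡 2) p →ₗ[ℝ] TangentSpace (𝓡 2) p}

lemma IsLift.isNonflatAt_im (h : IsLift f Ψ J) {p : M} (hp : IsNonflatAt f p) :
    IsNonflatAt Ψ p := by
  obtain ⟨ν, hν, hn, hinj⟩ := hp
  refine ⟨ν, hν, hn.mono fun q hq => ⟨hq.1, fun X => ?_⟩, hinj⟩
  rw [← h.diff_J]; exact hq.2 _

lemma firstForm_comm (f : M → Mink) (p : M) (X Y : TangentSpace (𝓡 2) p) :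
    firstForm f p X Y = firstForm f p Y X := lorentz_comm _ _

lemma IsLift.firstForm_J (h : IsLift f Ψ J) (p : M) (X Y : TangentSpace (𝓡 2) p) :
    firstForm f p (J p X) Y = -firstForm f p X (J p Y) := by
  rw [← (h.structure_re p X).2, (h.structure_re p Y).1]

lemma IsLift.diff_add (h : IsLift f Ψ J) (p : M) (X : TangentSpace (𝓡 2) p) :
    diff (f + Ψ) p X = diff f p (X + J p X) := by
  rw [TimelikeMinimal.diff_add (h.mdifferentiableAt p) (h.conj.mdifferentiableAt p), map_add,
    h.diff_J]

/-- `f + Ψ` is a null curve: its differential takes values in null vectors. -/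
lemma IsLift.null (h : IsLift f Ψ J) (p : M) (X : TangentSpace (𝓡 2) p) :
    lorentz (diff (f + Ψ) p X) (diff (f + Ψ) p X) = 0 := by
  have h1 := h.firstForm_J p X X
  rw [firstForm_comm] at h1
  have h2 := (h.structure_re p X).2 X
  rw [h.diff_add, map_add]
  simp only [lorentz_add_left, lorentz_add_right]
  simp only [firstForm] at h1 h2
  rw [lorentz_comm (diff f p (J p X)) (diff f p X)]
  linarith

/-- A tangent vector whose image under `d(f + Ψ)` has no time component lies in the kernel, which is
the `-1`-eigenspace of `J`. -/
lemma IsLift.J_eq_neg (h : IsLift f Ψ J) (hf : IsTimelike f) {p : M} {X : TangentSpace (𝓡 2) p}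
    (hX : diff (f + Ψ) p X 0 = 0) : J p X = -X := by
  have h1 := eq_zero_of_null (h.null p X) hX
  rw [h.diff_add] at h1
  have := (injective_iff_map_eq_zero _).1 (hf.injective_diff p) _ h1
  exact eq_neg_of_add_eq_zero_right this

lemma IsLift.diff_add_eq_smul (h : IsLift f Ψ J) {p : M} {X : TangentSpace (𝓡 2) p}
    (hX : diff (f + Ψ) p X 0 = 1) (Y : TangentSpace (𝓡 2) p) :
    diff (f + Ψ) p Y = diff (f + Ψ) p Y 0 • diff (f + Ψ) p X := by
  have h1 := eq_zero_of_null (h.null p (Y - diff (f + Ψ) p Y 0 • X)) (by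
    rw [map_sub, map_smul, Pi.sub_apply, Pi.smul_apply, hX, smul_eq_mul, mul_one, sub_self])
  rw [map_sub, map_smul, sub_eq_zero] at h1
  exact h1

/-- The inner products of the two null curves only depend on the first fundamental form and the
paracomplex structure. -/
lemma IsLift.lorentz_diff (h : IsLift f Ψ J) (p : M) (X Y : TangentSpace (𝓡 2) p) :
    lorentz (diff (f + Ψ) p X) (diff (f + -Ψ) p Y) = firstForm f p (X + J p X) (Y - J p Y) := by
  rw [h.diff_add, h.neg.diff_add, LinearMap.neg_apply, ← sub_eq_add_neg]; rfl

/-- Two paracomplex structures of isometric surfaces agree at a point up to a sign. -/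
lemma IsLift.J_eq_smul {g Ψ' : M → Mink}
    {J' : ∀ p : M, TangentSpace (𝓡 2) p →ₗ[ℝ] TangentSpace (𝓡 2) p} (h : IsLift f Ψ J)
    (h' : IsLift g Ψ' J') (hf : IsTimelike f) (p : M) (hp : IsNonflatAt f p)
    (hI : ∀ X Y, firstForm g p X Y = firstForm f p X Y) :
    ∃ c : ℝ, c ^ 2 = 1 ∧ ∀ X, J' p X = c • J p X := by
  obtain ⟨ν, -, hn, -⟩ := hp
  have hinj := hf.injective_diff p
  have hnondeg : ∀ X, (∀ Y, firstForm f p X Y = 0) → X = 0 := fun X hX =>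
    (injective_iff_map_eq_zero _).1 hinj _ (eq_zero_of_orthogonal (finrank_tangentSpace p) hinj
      hn.self_of_nhds.1 hn.self_of_nhds.2 (hn.self_of_nhds.2 X) hX)
  have hadd : ∀ X Y Z, firstForm f p (X + Y) Z = firstForm f p X Z + firstForm f p Y Z := by
    intro X Y Z; simp only [firstForm, map_add, lorentz_add_left]
  have hsmul : ∀ (c : ℝ) X Z, firstForm f p (c • X) Z = c * firstForm f p X Z := by
    intro c X Z; simp only [firstForm, map_smul, lorentz_smul_left]
  -- `I(JX, Y)` is an alternating form on a plane, hence determined by its value on a basis.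
  have : FiniteDimensional ℝ (TangentSpace (𝓡 2) p) :=
    FiniteDimensional.of_finrank_pos (by rw [finrank_tangentSpace]; norm_num)
  let b := Module.finBasisOfFinrankEq ℝ (TangentSpace (𝓡 2) p) (finrank_tangentSpace p)
  have hrep : ∀ Z, Z = b.repr Z 0 • b 0 + b.repr Z 1 • b 1 := fun Z => by
    conv_lhs => rw [← b.sum_repr Z, Fin.sum_univ_two]
  have key : ∀ K : TangentSpace (𝓡 2) p →ₗ[ℝ] TangentSpace (𝓡 2) p,
      (∀ X Y, firstForm f p (K X) Y = -firstForm f p X (K Y)) → ∀ X Y, firstForm f p (K X) Y =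
        (b.repr X 0 * b.repr Y 1 - b.repr X 1 * b.repr Y 0) * firstForm f p (K (b 0)) (b 1) := by
    intro K hK X Y
    have h00 := hK (b 0) (b 0)
    have h11 := hK (b 1) (b 1)
    have h10 := hK (b 1) (b 0)
    rw [firstForm_comm f p (b 0)] at h00
    rw [firstForm_comm f p (b 1)] at h11
    rw [firstForm_comm f p (b 1)] at h10
    conv_lhs => rw [hrep X, hrep Y]
    rw [map_add, map_smul, map_smul, hadd, hsmul, hsmul, firstForm_comm f p _ (_ + _),
      firstForm_comm f p _ (_ + _), hadd, hsmul, hsmul, hadd, hsmul, hsmul,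
      firstForm_comm f p _ (K _), firstForm_comm f p _ (K _), firstForm_comm f p _ (K _),
      firstForm_comm f p _ (K _), h10]
    have e0 : firstForm f p (K (b 0)) (b 0) = 0 := by linarith
    have e1 : firstForm f p (K (b 1)) (b 1) = 0 := by linarith
    rw [e0, e1]; ring
  have kJ := key (J p) (h.firstForm_J p)
  have kJ' := key (J' p) (fun X Y => by rw [← hI, ← hI, h'.firstForm_J])
  have hb0 : firstForm f p (J p (b 0)) (b 1) ≠ 0 := by
    intro h0
    have h1 : J p (b 0) = 0 := hnondeg _ fun Y => by rw [kJ, h0, mul_zero]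
    have h2 := (h.structure_re p (b 0)).1
    rw [h1, map_zero] at h2
    exact b.ne_zero 0 h2.symm
  set c := firstForm f p (J' p (b 0)) (b 1) / firstForm f p (J p (b 0)) (b 1)
  have hc : ∀ X, J' p X = c • J p X := by
    intro X
    refine sub_eq_zero.1 (hnondeg _ fun Y => ?_)
    rw [sub_eq_add_neg, ← neg_smul, hadd, hsmul, kJ, kJ']
    simp only [c]; field_simp; ring
  refine ⟨c, ?_, hc⟩
  have h1 := (h'.structure_re p (b 0)).1
  rw [hc, hc, map_smul, smul_smul, (h.structure_re p (b 0)).1] at h1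
  have h2 : (c * c - 1) • b 0 = 0 := by rw [sub_smul, h1, one_smul, sub_self]
  rcases smul_eq_zero.1 h2 with h3 | h3
  · rw [sq]; linarith
  · exact absurd h3 (b.ne_zero 0)

end Null

/-! ### Null coordinates -/

/-- On a box, a function whose derivative in the second variable vanishes is a function of the first
variable. -/
lemma eq_of_fderiv_snd_eq_zero {F : ℝ × ℝ → Mink} {w₀ : ℝ × ℝ} {r : ℝ}
    (hF : ∀ w ∈ Metric.ball w₀ r, DifferentiableAt ℝ F w)
    (h0 : ∀ w ∈ Metric.ball w₀ r, fderiv ℝ F w (0, 1) = 0) {u v v' : ℝ}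
    (hv : (u, v) ∈ Metric.ball w₀ r) (hv' : (u, v') ∈ Metric.ball w₀ r) : F (u, v) = F (u, v') := by
  rw [← ball_prod_same] at hv hv'
  have hmem : ∀ s ∈ Metric.ball w₀.2 r, (u, s) ∈ Metric.ball w₀ r := fun s hs => by
    rw [← ball_prod_same]; exact ⟨hv.1, hs⟩
  have hd : ∀ s ∈ Metric.ball w₀.2 r, HasDerivAt (fun s => F (u, s)) 0 s := by
    intro s hs
    have h1 : HasDerivAt (fun s : ℝ => (u, s)) ((0 : ℝ), (1 : ℝ)) s :=
      (hasDerivAt_const s u).prodMk (hasDerivAt_id s)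
    have h2 := (hF _ (hmem s hs)).hasFDerivAt.comp_hasDerivAt s h1
    rw [h0 _ (hmem s hs)] at h2
    exact h2
  exact Metric.isOpen_ball.is_const_of_deriv_eq_zero (convex_ball _ _).isPreconnected
    (fun s hs => (hd s hs).differentiableAt.differentiableWithinAt) (fun s hs => (hd s hs).deriv)
    hv.2 hv'.2

/-- Under the hypotheses of `eq_of_fderiv_snd_eq_zero`, the derivative in the first variable is a
function of the first variable, too. -/
lemma fderiv_fst_eq {F : ℝ × ℝ → Mink} {w₀ : ℝ × ℝ} {r : ℝ}
    (hF : ∀ w ∈ Metric.ball w₀ r, DifferentiableAt ℝ F w)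
    (h0 : ∀ w ∈ Metric.ball w₀ r, fderiv ℝ F w (0, 1) = 0) {u v v' : ℝ}
    (hv : (u, v) ∈ Metric.ball w₀ r) (hv' : (u, v') ∈ Metric.ball w₀ r) :
    fderiv ℝ F (u, v) (1, 0) = fderiv ℝ F (u, v') (1, 0) := by
  have hd : ∀ s, (u, s) ∈ Metric.ball w₀ r →
      HasDerivAt (fun t => F (t, s)) (fderiv ℝ F (u, s) (1, 0)) u := by
    intro s hs
    have h1 : HasDerivAt (fun t : ℝ => (t, s)) ((1 : ℝ), (0 : ℝ)) u :=
      (hasDerivAt_id u).prodMk (hasDerivAt_const u s)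
    exact (hF _ hs).hasFDerivAt.comp_hasDerivAt u h1
  refine (hd v hv).unique ((hd v' hv').congr_of_eventuallyEq ?_)
  have h1 : ∀ s, (u, s) ∈ Metric.ball w₀ r → ∀ᶠ t in 𝓝 u, (t, s) ∈ Metric.ball w₀ r := by
    intro s hs
    exact (Continuous.prodMk_left s).continuousAt.preimage_mem_nhds (Metric.isOpen_ball.mem_nhds hs)
  filter_upwards [h1 v hv, h1 v' hv'] with t ht ht'
  exact eq_of_fderiv_snd_eq_zero hF h0 ht ht'

section NullChart

variable {M : Type*} [TopologicalSpace M] [ChartedSpace Plane M]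

lemma fderiv_comp_param {F : M → Mink} {κ : ℝ × ℝ → M} {w : ℝ × ℝ}
    (hF : MDifferentiableAt (𝓡 2) 𝓘(ℝ, Mink) F (κ w))
    (hκ : MDifferentiableAt 𝓘(ℝ, ℝ × ℝ) (𝓡 2) κ w) (V : ℝ × ℝ) :
    fderiv ℝ (F ∘ κ) w V = diff F (κ w) (mfderiv 𝓘(ℝ, ℝ × ℝ) (𝓡 2) κ w V) := by
  have h1 := mfderiv_comp_apply (I := 𝓘(ℝ, ℝ × ℝ)) w hF hκ V
  rw [mfderiv_eq_fderiv] at h1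
  exact h1

variable [IsManifold (𝓡 2) ∞ M]

/-- Two functions with independent differentials are local coordinates. -/
lemma exists_coordinates {P Q : M → Mink} (hP : ContMDiff (𝓡 2) 𝓘(ℝ, Mink) ∞ P)
    (hQ : ContMDiff (𝓡 2) 𝓘(ℝ, Mink) ∞ Q) {p : M}
    (hinj : ∀ X, diff P p X 0 = 0 → diff Q p X 0 = 0 → X = 0) :
    ∃ κ : ℝ × ℝ → M, κ (P p 0, Q p 0) = p ∧
      ContMDiffAt 𝓘(ℝ, ℝ × ℝ) (𝓡 2) ∞ κ (P p 0, Q p 0) ∧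
      (∀ᶠ w in 𝓝 (P p 0, Q p 0), P (κ w) 0 = w.1 ∧ Q (κ w) 0 = w.2) ∧
      ∀ᶠ x in 𝓝 p, κ (P x 0, Q x 0) = x := by
  set e := chartAt Plane p
  have hp : p ∈ e.source := mem_chart_source Plane p
  have hz := e.map_source hp
  have hs : ∀ {F : M → Mink}, ContMDiff (𝓡 2) 𝓘(ℝ, Mink) ∞ F →
      ContDiffAt ℝ ∞ (F ∘ e.symm) (e p) := fun hF =>
    (hF.contMDiffAt.comp (e p) (contMDiffAt_chart_symm hz)).contDiffAt
  set H : Plane → ℝ × ℝ := fun z => ((P ∘ e.symm) z 0, (Q ∘ e.symm) z 0) with hH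
  have hHs : ContDiffAt ℝ ∞ H (e p) :=
    (contDiffAt_pi.1 (hs hP) 0).prodMk (contDiffAt_pi.1 (hs hQ) 0)
  set π : Mink →L[ℝ] ℝ := ContinuousLinearMap.proj 0
  have hHd : HasFDerivAt H ((π.comp (fderiv ℝ (P ∘ e.symm) (e p))).prod
      (π.comp (fderiv ℝ (Q ∘ e.symm) (e p)))) (e p) :=
    (π.hasFDerivAt.comp (e p) ((hs hP).differentiableAt (by simp)).hasFDerivAt).prodMk
      (π.hasFDerivAt.comp (e p) ((hs hQ).differentiableAt (by simp)).hasFDerivAt)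
  set D := (π.comp (fderiv ℝ (P ∘ e.symm) (e p))).prod
      (π.comp (fderiv ℝ (Q ∘ e.symm) (e p))) with hD
  -- The composition of `D` with the differential of the chart is injective, so `D` is onto.
  have hsurj : Function.Surjective D.toLinearMap := by
    let de : Plane →ₗ[ℝ] Plane := (mfderiv (𝓡 2) (𝓡 2) e p).toLinearMap
    have hcomp : Function.Injective (D.toLinearMap ∘ₗ de) := by
      refine (injective_iff_map_eq_zero _).2 fun X hX => ?_
      have h1 := congrArg Prod.fst hX
      have h2 := congrArg Prod.snd hX
      refine hinj X ?_ ?_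
      · exact (congrFun (diff_eq_fderiv_chart hp (hP.contMDiffAt.mdifferentiableAt (by simp)) X)
          0).trans h1
      · exact (congrFun (diff_eq_fderiv_chart hp (hQ.contMDiffAt.mdifferentiableAt (by simp)) X)
          0).trans h2
    have := (LinearMap.injective_iff_surjective_of_finrank_eq_finrank (by simp)).1 hcomp
    exact Function.Surjective.of_comp this
  have hinj' := (LinearMap.injective_iff_surjective_of_finrank_eq_finrank (by simp)).2 hsurj
  let D' : Plane ≃L[ℝ] ℝ × ℝ :=
    (LinearEquiv.ofBijective D.toLinearMap ⟨hinj', hsurj⟩).toContinuousLinearEquiv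
  have hD' : (D' : Plane →L[ℝ] ℝ × ℝ) = D := by ext1 X; rfl
  have hHd' : HasFDerivAt H (D' : Plane →L[ℝ] ℝ × ℝ) (e p) := by rw [hD']; exact hHd
  have hstrict : HasStrictFDerivAt H (D' : Plane →L[ℝ] ℝ × ℝ) (e p) :=
    hHs.hasStrictFDerivAt' hHd' (by simp)
  set G := hHs.localInverse hHd' (by simp) with hG
  have hHp : H (e p) = (P p 0, Q p 0) := by simp [hH, e.left_inv hp]
  have hGp : G (P p 0, Q p 0) = e p := by
    rw [← hHp]; exact hHs.localInverse_apply_image hHd' (by simp)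
  have hGs : ContDiffAt ℝ ∞ G (P p 0, Q p 0) := by
    rw [← hHp]; exact hHs.to_localInverse hHd' (by simp)
  refine ⟨e.symm ∘ G, ?_, ?_, ?_, ?_⟩
  · simp [hGp, e.left_inv hp]
  · exact ContMDiffAt.comp _ (by rw [hGp]; exact contMDiffAt_chart_symm hz) hGs.contMDiffAt
  · have := hstrict.eventually_right_inverse
    rw [hHp] at this
    filter_upwards [this] with w hw
    exact ⟨congrArg Prod.fst hw, congrArg Prod.snd hw⟩
  · filter_upwards [(e.continuousAt hp).eventually hstrict.eventually_left_inverse,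
      e.open_source.mem_nhds hp] with x hx hxs
    have h1 : H (e x) = (P x 0, Q x 0) := by simp [hH, e.left_inv hxs]
    rw [h1] at hx
    change e.symm (G (P x 0, Q x 0)) = x
    rw [← e.left_inv hxs]
    congr 1
    rw [e.left_inv hxs]; exact hx

/-- `κ` is a parametrization by null coordinates of the box of radius `r` around `w₀`. The time
components of the null curves `f + Ψ` and `f - Ψ` serve as coordinates. -/
structure IsNullChart (f Ψ : M → Mink) (κ : ℝ × ℝ → M) (w₀ : ℝ × ℝ) (r : ℝ) : Prop where
  pos : 0 < r
  smooth : ∀ w ∈ Metric.ball w₀ r, ContMDiffAt 𝓘(ℝ, ℝ × ℝ) (𝓡 2) 1 κ w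
  fst : ∀ w ∈ Metric.ball w₀ r, (f + Ψ) (κ w) 0 = w.1
  snd : ∀ w ∈ Metric.ball w₀ r, (f + -Ψ) (κ w) 0 = w.2

variable {f Ψ : M → Mink} {J : ∀ p : M, TangentSpace (𝓡 2) p →ₗ[ℝ] TangentSpace (𝓡 2) p}

/-- Null charts exist because a null vector without time component vanishes. -/
lemma exists_isNullChart (h : IsLift f Ψ J) (hf : IsTimelike f) (p : M) {V : Set M} (hV : V ∈ 𝓝 p) :
    ∃ κ w₀ r, IsNullChart f Ψ κ w₀ r ∧ κ w₀ = p ∧ (∀ w ∈ Metric.ball w₀ r, κ w ∈ V) ∧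
      ∀ W ∈ 𝓝 w₀, ∀ᶠ x in 𝓝 p, ∃ w ∈ W, κ w = x := by
  have hP : ContMDiff (𝓡 2) 𝓘(ℝ, Mink) ∞ (f + Ψ) := h.smooth.add h.smooth_im
  have hQ : ContMDiff (𝓡 2) 𝓘(ℝ, Mink) ∞ (f + -Ψ) := h.smooth.add h.neg.smooth_im
  obtain ⟨κ, hκp, hκ, hw, hx⟩ := exists_coordinates hP hQ (p := p) fun X h1 h2 => by
    have e1 := h.J_eq_neg hf h1
    have e2 := h.neg.J_eq_neg hf h2
    rw [LinearMap.neg_apply, e1, neg_neg] at e2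
    have e3 : (2 : ℝ) • X = 0 := by
      rw [two_smul]; nth_rewrite 1 [e2]; exact neg_add_cancel X
    exact (smul_eq_zero.1 e3).resolve_left two_ne_zero
  have hκ1 : ∀ᶠ w in 𝓝 ((f + Ψ) p 0, (f + -Ψ) p 0), ContMDiffAt 𝓘(ℝ, ℝ × ℝ) (𝓡 2) 1 κ w :=
    (contMDiffAt_iff_contMDiffAt_nhds (n := 1) (by simp)).1 (hκ.of_le (by simp))
  have hκV : ∀ᶠ w in 𝓝 ((f + Ψ) p 0, (f + -Ψ) p 0), κ w ∈ V :=
    hκ.continuousAt.preimage_mem_nhds (by rw [hκp]; exact hV)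
  obtain ⟨r, hr, hball⟩ := Metric.eventually_nhds_iff_ball.1 (hκ1.and (hκV.and hw))
  refine ⟨κ, _, r, ⟨hr, fun w hw => (hball w hw).1, fun w hw => (hball w hw).2.2.1,
    fun w hw => (hball w hw).2.2.2⟩, hκp, fun w hw => (hball w hw).2.1, fun W hW => ?_⟩
  have hcont : ContinuousAt (fun x => ((f + Ψ) x 0, (f + -Ψ) x 0)) p :=
    ((continuous_apply 0).continuousAt.comp hP.continuous.continuousAt).prodMk
      ((continuous_apply 0).continuousAt.comp hQ.continuous.continuousAt)
  filter_upwards [hx, hcont.preimage_mem_nhds hW] with x hx hxr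
  exact ⟨_, hxr, hx⟩

end NullChart

/-! ### Local rigidity -/

section LocalRigidity

variable {M : Type*} [TopologicalSpace M] [ChartedSpace Plane M]
  {f Ψ : M → Mink} {J : ∀ p : M, TangentSpace (𝓡 2) p →ₗ[ℝ] TangentSpace (𝓡 2) p}
  {κ : ℝ × ℝ → M} {w₀ : ℝ × ℝ} {r : ℝ}

lemma fderiv_comp_swap (F : ℝ × ℝ → Mink) (w V : ℝ × ℝ) :
    fderiv ℝ (F ∘ Prod.swap) w V = fderiv ℝ F w.swap V.swap := by
  have := (ContinuousLinearEquiv.prodComm ℝ ℝ ℝ).comp_right_fderiv (f := F) (x := w)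
  exact DFunLike.congr_fun this V

lemma swap_mem_ball {w : ℝ × ℝ} (hw : w ∈ Metric.ball w₀.swap r) : w.swap ∈ Metric.ball w₀ r := by
  rw [← ball_prod_same] at hw
  rw [← Prod.mk.eta (p := w₀), ← ball_prod_same]
  exact ⟨hw.2, hw.1⟩

lemma IsNullChart.swap (hc : IsNullChart f Ψ κ w₀ r) :
    IsNullChart f (-Ψ) (κ ∘ Prod.swap) w₀.swap r := by
  refine ⟨hc.pos, fun w hw => ?_, fun w hw => hc.snd _ (swap_mem_ball hw), fun w hw => ?_⟩
  · have h1 : ContMDiffAt 𝓘(ℝ, ℝ × ℝ) 𝓘(ℝ, ℝ × ℝ) 1 (Prod.swap : ℝ × ℝ → ℝ × ℝ) w :=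
      (contDiff_snd.prodMk contDiff_fst).contMDiff.contMDiffAt
    exact ContMDiffAt.comp w (hc.smooth _ (swap_mem_ball hw)) h1
  · rw [neg_neg]; exact hc.fst _ (swap_mem_ball hw)

lemma IsNullChart.mdifferentiableAt (hc : IsNullChart f Ψ κ w₀ r) {w : ℝ × ℝ}
    (hw : w ∈ Metric.ball w₀ r) : MDifferentiableAt 𝓘(ℝ, ℝ × ℝ) (𝓡 2) κ w :=
  (hc.smooth w hw).mdifferentiableAt one_ne_zero

lemma IsNullChart.contDiffAt (hc : IsNullChart f Ψ κ w₀ r) {F : M → Mink}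
    (hF : ContMDiff (𝓡 2) 𝓘(ℝ, Mink) ∞ F) {w : ℝ × ℝ} (hw : w ∈ Metric.ball w₀ r) :
    ContDiffAt ℝ 1 (F ∘ κ) w :=
  ((hF.contMDiffAt.of_le (by simp)).comp w (hc.smooth w hw)).contDiffAt

lemma IsLift.smooth_add (h : IsLift f Ψ J) : ContMDiff (𝓡 2) 𝓘(ℝ, Mink) ∞ (f + Ψ) :=
  h.smooth.add h.smooth_im

/-- The coordinate vector fields of a parametrization. -/
noncomputable def coordField (κ : ℝ × ℝ → M) (w V : ℝ × ℝ) : TangentSpace (𝓡 2) (κ w) :=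
  mfderiv 𝓘(ℝ, ℝ × ℝ) (𝓡 2) κ w V

lemma IsNullChart.fderiv_comp (hc : IsNullChart f Ψ κ w₀ r) {F : M → Mink}
    (hF : ContMDiff (𝓡 2) 𝓘(ℝ, Mink) ∞ F) {w : ℝ × ℝ} (hw : w ∈ Metric.ball w₀ r) (V : ℝ × ℝ) :
    fderiv ℝ (F ∘ κ) w V = diff F (κ w) (coordField κ w V) :=
  fderiv_comp_param (hF.contMDiffAt.mdifferentiableAt (by simp)) (hc.mdifferentiableAt hw) V

lemma IsNullChart.diff_add_time (hc : IsNullChart f Ψ κ w₀ r) (h : IsLift f Ψ J) {w : ℝ × ℝ}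
    (hw : w ∈ Metric.ball w₀ r) (V : ℝ × ℝ) :
    diff (f + Ψ) (κ w) (coordField κ w V) 0 = V.1 := by
  rw [← hc.fderiv_comp h.smooth_add hw]
  let π : Mink →L[ℝ] ℝ := ContinuousLinearMap.proj 0
  have h1 : HasFDerivAt (fun w => ((f + Ψ) ∘ κ) w 0) (π.comp (fderiv ℝ ((f + Ψ) ∘ κ) w)) w :=
    π.hasFDerivAt.comp w
      ((hc.contDiffAt h.smooth_add hw).differentiableAt one_ne_zero).hasFDerivAt
  have h2 : HasFDerivAt (fun w => ((f + Ψ) ∘ κ) w 0) (ContinuousLinearMap.fst ℝ ℝ ℝ) w := by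
    refine (ContinuousLinearMap.fst ℝ ℝ ℝ).hasFDerivAt.congr_of_eventuallyEq ?_
    filter_upwards [Metric.isOpen_ball.mem_nhds hw] with z hz
    exact hc.fst z hz
  exact DFunLike.congr_fun (h1.unique h2) V

lemma IsNullChart.diff_sub_time (hc : IsNullChart f Ψ κ w₀ r) (h : IsLift f Ψ J) {w : ℝ × ℝ}
    (hw : w ∈ Metric.ball w₀ r) (V : ℝ × ℝ) :
    diff (f + -Ψ) (κ w) (coordField κ w V) 0 = V.2 := by
  have hw' : w.swap ∈ Metric.ball w₀.swap r := swap_mem_ball (w₀ := w₀.swap) (by simpa using hw)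
  have h1 := hc.swap.diff_add_time h.neg hw' V.swap
  rw [← hc.swap.fderiv_comp h.neg.smooth_add hw', ← Function.comp_assoc, fderiv_comp_swap] at h1
  rw [← hc.fderiv_comp h.neg.smooth_add hw]
  exact h1

lemma IsNullChart.J_fst (hc : IsNullChart f Ψ κ w₀ r) (h : IsLift f Ψ J) (hf : IsTimelike f)
    {w : ℝ × ℝ} (hw : w ∈ Metric.ball w₀ r) :
    J (κ w) (coordField κ w (1, 0)) = coordField κ w (1, 0) := by
  have := h.neg.J_eq_neg hf (hc.diff_sub_time h hw (1, 0))
  exact neg_injective this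

lemma IsNullChart.J_snd (hc : IsNullChart f Ψ κ w₀ r) (h : IsLift f Ψ J) (hf : IsTimelike f)
    {w : ℝ × ℝ} (hw : w ∈ Metric.ball w₀ r) :
    J (κ w) (coordField κ w (0, 1)) = -coordField κ w (0, 1) :=
  h.J_eq_neg hf (hc.diff_add_time h hw (0, 1))

/-- The null curve `g + Ψ'` of a surface with the same paracomplex structure depends on the first
null coordinate only. -/
lemma IsNullChart.fderiv_snd_eq_zero (hc : IsNullChart f Ψ κ w₀ r) (h : IsLift f Ψ J)
    (hf : IsTimelike f) {g Ψ' : M → Mink}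
    {J' : ∀ p : M, TangentSpace (𝓡 2) p →ₗ[ℝ] TangentSpace (𝓡 2) p} (h' : IsLift g Ψ' J')
    {w : ℝ × ℝ} (hw : w ∈ Metric.ball w₀ r) (hJ : ∀ X, J' (κ w) X = J (κ w) X) :
    fderiv ℝ ((g + Ψ') ∘ κ) w (0, 1) = 0 := by
  rw [hc.fderiv_comp h'.smooth_add hw, h'.diff_add, hJ, hc.J_snd h hf hw, add_neg_cancel, map_zero]

lemma IsNullChart.center_mem (hc : IsNullChart f Ψ κ w₀ r) : w₀ ∈ Metric.ball w₀ r :=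
  Metric.mem_ball_self hc.pos

lemma mk_mem_ball {u v : ℝ} (hu : u ∈ Metric.ball w₀.1 r) (hv : v ∈ Metric.ball w₀.2 r) :
    (u, v) ∈ Metric.ball w₀ r := by
  rw [← Prod.mk.eta (p := w₀), ← ball_prod_same]; exact ⟨hu, hv⟩

lemma IsNullChart.fderiv_fst_eq (hc : IsNullChart f Ψ κ w₀ r) (h : IsLift f Ψ J)
    (hf : IsTimelike f) {g Ψ' : M → Mink}
    {J' : ∀ p : M, TangentSpace (𝓡 2) p →ₗ[ℝ] TangentSpace (𝓡 2) p} (h' : IsLift g Ψ' J')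
    (hJ : ∀ w ∈ Metric.ball w₀ r, ∀ X, J' (κ w) X = J (κ w) X) {u v v' : ℝ}
    (hv : (u, v) ∈ Metric.ball w₀ r) (hv' : (u, v') ∈ Metric.ball w₀ r) :
    fderiv ℝ ((g + Ψ') ∘ κ) (u, v) (1, 0) = fderiv ℝ ((g + Ψ') ∘ κ) (u, v') (1, 0) :=
  TimelikeMinimal.fderiv_fst_eq
    (fun _ hw => (hc.contDiffAt h'.smooth_add hw).differentiableAt one_ne_zero)
    (fun w hw => hc.fderiv_snd_eq_zero h hf h' hw (hJ w hw)) hv hv'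

lemma IsNullChart.fderiv_snd_eq (hc : IsNullChart f Ψ κ w₀ r) (h : IsLift f Ψ J)
    (hf : IsTimelike f) {g Ψ' : M → Mink}
    {J' : ∀ p : M, TangentSpace (𝓡 2) p →ₗ[ℝ] TangentSpace (𝓡 2) p} (h' : IsLift g Ψ' J')
    (hJ : ∀ w ∈ Metric.ball w₀ r, ∀ X, J' (κ w) X = J (κ w) X) {u u' v : ℝ}
    (hu : (u, v) ∈ Metric.ball w₀ r) (hu' : (u', v) ∈ Metric.ball w₀ r) :
    fderiv ℝ ((g + -Ψ') ∘ κ) (u, v) (0, 1) = fderiv ℝ ((g + -Ψ') ∘ κ) (u', v) (0, 1) := by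
  have hmem : ∀ w : ℝ × ℝ, w ∈ Metric.ball w₀ r → w.swap ∈ Metric.ball w₀.swap r := fun w hw =>
    swap_mem_ball (by rwa [Prod.swap_swap])
  have h1 := hc.swap.fderiv_fst_eq h.neg hf h'.neg
    (fun w hw X => congrArg Neg.neg (hJ w.swap (swap_mem_ball hw) X)) (u := v) (v := u) (v' := u')
    (hmem _ hu) (hmem _ hu')
  rw [← Function.comp_assoc, fderiv_comp_swap, fderiv_comp_swap] at h1
  exact h1

/-- The tangent direction of the null curve `f + Ψ` of a surface without flat points takes
infinitely many values. Otherwise it would be constant, and the unit normal would be constant along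
the first null coordinate. -/
lemma IsNullChart.infinite_directions (hc : IsNullChart f Ψ κ w₀ r) (h : IsLift f Ψ J)
    (hf : IsTimelike f) (hN : IsNonflatAt f (κ w₀)) :
    (Set.range fun u : Metric.ball w₀.1 r =>
      fderiv ℝ ((f + Ψ) ∘ κ) (u, w₀.2) (1, 0)).Infinite := by
  set a : ℝ → Mink := fun u => fderiv ℝ ((f + Ψ) ∘ κ) (u, w₀.2) (1, 0) with ha
  have hr := hc.pos
  have hu₀ : w₀.1 ∈ Metric.ball w₀.1 r := Metric.mem_ball_self hr
  have hv₀ : w₀.2 ∈ Metric.ball w₀.2 r := Metric.mem_ball_self hr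
  have hrange : (Set.range fun u : Metric.ball w₀.1 r =>
      fderiv ℝ ((f + Ψ) ∘ κ) (u, w₀.2) (1, 0)) = a '' Metric.ball w₀.1 r := by
    rw [Set.image_eq_range]
  rw [hrange]
  have hacont : ContinuousOn a (Metric.ball w₀.1 r) := by
    intro u hu
    have h1 : ContinuousAt (fderiv ℝ ((f + Ψ) ∘ κ)) (u, w₀.2) :=
      ((hc.contDiffAt h.smooth_add (mk_mem_ball hu hv₀)).fderiv_right (m := 0)
        (by simp)).continuousAt
    have h2 : ContinuousAt (fun u => fderiv ℝ ((f + Ψ) ∘ κ) (u, w₀.2)) u :=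
      ContinuousAt.comp (f := fun u : ℝ => (u, w₀.2)) h1 (by fun_prop)
    exact (h2.clm_apply continuousAt_const).continuousWithinAt
  refine ((convex_ball w₀.1 r).isPreconnected.image a hacont).infinite_of_nontrivial ?_
  by_contra hsub
  rw [Set.not_nontrivial_iff] at hsub
  have hconst : ∀ u ∈ Metric.ball w₀.1 r, a u = a w₀.1 := fun u hu =>
    hsub (Set.mem_image_of_mem a hu) (Set.mem_image_of_mem a hu₀)
  obtain ⟨ν, hν, hn, hinj⟩ := hN
  have hw₀ := hc.center_mem
  have hκ := hc.mdifferentiableAt hw₀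
  have hN : DifferentiableAt ℝ (ν ∘ κ) w₀ :=
    (MDifferentiableAt.comp w₀ (hν.mdifferentiableAt (by simp)) hκ).differentiableAt
  -- the derivative of the normal along the first null coordinate
  set y : Mink := diff ν (κ w₀) (coordField κ w₀ (1, 0)) with hy
  have hyd : HasDerivAt (fun u => (ν ∘ κ) (u, w₀.2)) y w₀.1 := by
    have h1 : HasDerivAt (fun t : ℝ => (t, w₀.2)) ((1 : ℝ), (0 : ℝ)) w₀.1 :=
      (hasDerivAt_id _).prodMk (hasDerivAt_const _ _)
    have h2 := hN.hasFDerivAt.comp_hasDerivAt w₀.1 (f := fun t : ℝ => (t, w₀.2)) h1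
    rw [fderiv_comp_param (hν.mdifferentiableAt (by simp)) hκ] at h2
    exact h2
  have hline : ∀ᶠ u in 𝓝 w₀.1, u ∈ Metric.ball w₀.1 r ∧ IsUnitNormalAt f ν (κ (u, w₀.2)) := by
    refine Filter.Eventually.and (p := fun u => u ∈ Metric.ball w₀.1 r)
      (Metric.ball_mem_nhds _ hr) ?_
    have h1 : ContinuousAt (fun u : ℝ => κ (u, w₀.2)) w₀.1 :=
      ContinuousAt.comp (f := fun u : ℝ => (u, w₀.2)) (x := w₀.1) hκ.continuousAt (by fun_prop)
    exact h1.eventually hn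
  have horth : ∀ c : Mink, (∀ᶠ u in 𝓝 w₀.1, lorentz c ((ν ∘ κ) (u, w₀.2)) = 0) →
      lorentz c y = 0 := by
    intro c hc0
    let l : Mink →L[ℝ] ℝ := LinearMap.toContinuousLinearMap (lorentzForm c)
    have h1 : HasDerivAt (fun u => lorentz c ((ν ∘ κ) (u, w₀.2))) (lorentz c y) w₀.1 :=
      l.hasFDerivAt.comp_hasDerivAt w₀.1 hyd
    exact h1.unique ((hasDerivAt_const w₀.1 (0 : ℝ)).congr_of_eventuallyEq hc0)
  have hy1 : lorentz (a w₀.1) y = 0 := by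
    refine horth _ (hline.mono fun u hu => ?_)
    rw [← hconst u hu.1]
    simp only [ha]
    rw [hc.fderiv_comp h.smooth_add (mk_mem_ball hu.1 hv₀), h.diff_add, lorentz_comm]
    exact hu.2.2 _
  have hy2 : lorentz (fderiv ℝ ((f + -Ψ) ∘ κ) w₀ (0, 1)) y = 0 := by
    refine horth _ (hline.mono fun u hu => ?_)
    have hmem := mk_mem_ball hu.1 hv₀
    have h1 : fderiv ℝ ((f + -Ψ) ∘ κ) w₀ (0, 1) = fderiv ℝ ((f + -Ψ) ∘ κ) (u, w₀.2) (0, 1) :=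
      hc.fderiv_snd_eq h hf h (fun w _ X => rfl) hc.center_mem hmem
    rw [h1, hc.fderiv_comp h.neg.smooth_add hmem, h.neg.diff_add, lorentz_comm]
    exact hu.2.2 _
  have hy3 : lorentz (ν (κ w₀)) y = 0 := by
    have h1 : HasDerivAt (fun u => lorentz ((ν ∘ κ) (u, w₀.2)) ((ν ∘ κ) (u, w₀.2)))
        (2 * lorentz (ν (κ w₀)) y) w₀.1 := by
      have hi := hasDerivAt_pi.1 hyd
      have := (((hi 0).mul (hi 0)).neg.add ((hi 1).mul (hi 1))).add ((hi 2).mul (hi 2))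
      refine this.congr_deriv ?_
      simp only [lorentz, Function.comp_apply, Prod.mk.eta]; ring
    have h2 := h1.unique ((hasDerivAt_const w₀.1 (1 : ℝ)).congr_of_eventuallyEq
      (hline.mono fun u hu => hu.2.1))
    linarith
  have hP0 : diff (f + Ψ) (κ w₀) (coordField κ w₀ (1, 0)) 0 = 1 := hc.diff_add_time h hw₀ (1, 0)
  have hQ0 : diff (f + -Ψ) (κ w₀) (coordField κ w₀ (0, 1)) 0 = 1 := hc.diff_sub_time h hw₀ (0, 1)
  have ea : a w₀.1 = diff (f + Ψ) (κ w₀) (coordField κ w₀ (1, 0)) :=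
    hc.fderiv_comp h.smooth_add hw₀ (1, 0)
  rw [ea] at hy1
  rw [hc.fderiv_comp h.neg.smooth_add hw₀] at hy2
  have hy0 : y = 0 := by
    refine eq_zero_of_orthogonal (finrank_tangentSpace (κ w₀)) (hf.injective_diff (κ w₀))
      hn.self_of_nhds.1 hn.self_of_nhds.2 hy3 fun X => ?_
    have h1 := h.diff_add_eq_smul hP0 X
    have h2 := h.neg.diff_add_eq_smul hQ0 X
    have h3 : diff f (κ w₀) X + diff f (κ w₀) X =
        diff (f + Ψ) (κ w₀) X + diff (f + -Ψ) (κ w₀) X := by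
      rw [h.diff_add, h.neg.diff_add, ← map_add, ← map_add]
      congr 1
      rw [LinearMap.neg_apply]; abel
    have h4 : lorentz (diff f (κ w₀) X + diff f (κ w₀) X) y = 0 := by
      rw [h3, h1, h2, lorentz_add_left, lorentz_smul_left, lorentz_smul_left, hy1, hy2]; ring
    rw [lorentz_add_left] at h4
    rw [lorentz_comm]; linarith
  have hX0 := (injective_iff_map_eq_zero _).1 hinj _ hy0
  rw [hX0, map_zero] at hP0
  exact zero_ne_one hP0

end LocalRigidity

section Rigidity

variable {M : Type*} [TopologicalSpace M] [ChartedSpace Plane M]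
  {f Ψ g Ψ' : M → Mink} {J J' : ∀ p : M, TangentSpace (𝓡 2) p →ₗ[ℝ] TangentSpace (𝓡 2) p}
  {κ : ℝ × ℝ → M} {w₀ : ℝ × ℝ} {r : ℝ}

/-- The member `Re (e^{jθ} (f + j Ψ))` of the associated family. -/
noncomputable def assocMember (f Ψ : M → Mink) (θ : ℝ) : M → Mink :=
  Real.cosh θ • f + Real.sinh θ • Ψ

lemma IsLift.smooth_assocMember (h : IsLift f Ψ J) (θ : ℝ) (q : M) :
    ContMDiffAt (𝓡 2) 𝓘(ℝ, Mink) ∞ (assocMember f Ψ θ) q :=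
  (contMDiffAt_smul h.smooth.contMDiffAt _).add (contMDiffAt_smul h.smooth_im.contMDiffAt _)

lemma IsLift.diff_assocMember (h : IsLift f Ψ J) (θ : ℝ) (q : M) (X : TangentSpace (𝓡 2) q) :
    diff (assocMember f Ψ θ) q X = Real.cosh θ • diff f q X + Real.sinh θ • diff f q (J q X) := by
  rw [assocMember, TimelikeMinimal.diff_add, diff_smul (h.mdifferentiableAt q),
    diff_smul (h.conj.mdifferentiableAt q), h.diff_J]
  · exact (contMDiffAt_smul h.smooth.contMDiffAt _).mdifferentiableAt (by simp)
  · exact (contMDiffAt_smul h.smooth_im.contMDiffAt _).mdifferentiableAt (by simp)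

lemma IsLift.diff_assocMember_pos (h : IsLift f Ψ J) (θ : ℝ) {q : M} {X : TangentSpace (𝓡 2) q}
    (hX : J q X = X) : diff (assocMember f Ψ θ) q X = Real.exp θ • diff f q X := by
  rw [h.diff_assocMember, hX, ← add_smul, Real.cosh_add_sinh]

lemma IsLift.diff_assocMember_neg (h : IsLift f Ψ J) (θ : ℝ) {q : M} {X : TangentSpace (𝓡 2) q}
    (hX : J q X = -X) : diff (assocMember f Ψ θ) q X = Real.exp (-θ) • diff f q X := by
  rw [h.diff_assocMember, hX, map_neg, smul_neg, ← sub_eq_add_neg, ← sub_smul,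
    Real.cosh_sub_sinh]

lemma IsNullChart.eq_coordField (hc : IsNullChart f Ψ κ w₀ r) (h : IsLift f Ψ J)
    (hf : IsTimelike f) {w : ℝ × ℝ} (hw : w ∈ Metric.ball w₀ r) (X : TangentSpace (𝓡 2) (κ w)) :
    X = diff (f + Ψ) (κ w) X 0 • coordField κ w (1, 0)
      + diff (f + -Ψ) (κ w) X 0 • coordField κ w (0, 1) := by
  refine sub_eq_zero.1 ?_
  set Y := X - (diff (f + Ψ) (κ w) X 0 • coordField κ w (1, 0)
      + diff (f + -Ψ) (κ w) X 0 • coordField κ w (0, 1)) with hY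
  have h1 : diff (f + Ψ) (κ w) Y 0 = 0 := by
    rw [hY, map_sub, map_add, map_smul, map_smul]
    simp only [Pi.sub_apply, Pi.add_apply, Pi.smul_apply, hc.diff_add_time h hw, smul_eq_mul]
    ring
  have h2 : diff (f + -Ψ) (κ w) Y 0 = 0 := by
    rw [hY, map_sub, map_add, map_smul, map_smul]
    simp only [Pi.sub_apply, Pi.add_apply, Pi.smul_apply, hc.diff_sub_time h hw, smul_eq_mul]
    ring
  have e1 := h.J_eq_neg hf h1
  have e2 := h.neg.J_eq_neg hf h2
  rw [LinearMap.neg_apply, e1, neg_neg] at e2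
  have e3 : (2 : ℝ) • Y = 0 := by
    rw [two_smul]; nth_rewrite 1 [e2]; exact neg_add_cancel Y
  exact (smul_eq_zero.1 e3).resolve_left two_ne_zero

lemma diff_half_pos (h' : IsLift g Ψ' J') {q : M} {X : TangentSpace (𝓡 2) q} (hX : J' q X = X) :
    diff (g + Ψ') q X = (2 : ℝ) • diff g q X := by
  rw [h'.diff_add, hX, map_add, two_smul]

variable [IsManifold (𝓡 2) ∞ M]

/-- If the paracomplex structures of two isometric surfaces agree at a point, they agree nearby. -/
lemma eventually_J_eq (h : IsLift f Ψ J) (h' : IsLift g Ψ' J') (hf : IsTimelike f)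
    (hg : IsTimelike g) (hN : ∀ q, IsNonflatAt f q)
    (hI : ∀ q X Y, firstForm g q X Y = firstForm f q X Y) {p : M} (hp : ∀ X, J' p X = J p X) :
    ∀ᶠ q in 𝓝 p, ∀ X, J' q X = J q X := by
  obtain ⟨κ, w₀, r, hc, rfl, -, hcov⟩ := exists_isNullChart h hf p Filter.univ_mem
  refine (hcov {w | ∀ X, J' (κ w) X = J (κ w) X} ?_).mono ?_
  · have hcont : ContinuousAt (fun w => fderiv ℝ ((g + Ψ') ∘ κ) w (1, 0)) w₀ :=
      ((hc.contDiffAt h'.smooth_add hc.center_mem).fderiv_right (m := 0)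
        (by simp)).continuousAt.clm_apply continuousAt_const
    have hX0 : ∀ w ∈ Metric.ball w₀ r, coordField κ w (1, 0) ≠ 0 := by
      intro w hw h0
      have := hc.diff_add_time h hw (1, 0)
      rw [h0, map_zero] at this
      exact zero_ne_one this
    have hne : fderiv ℝ ((g + Ψ') ∘ κ) w₀ (1, 0) ≠ 0 := by
      have hw := hc.center_mem
      rw [hc.fderiv_comp h'.smooth_add hw, diff_half_pos h' (by rw [hp, hc.J_fst h hf hw])]
      refine smul_ne_zero two_ne_zero fun h0 => hX0 w₀ hw ?_
      exact (injective_iff_map_eq_zero _).1 (hg.injective_diff _) _ h0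
    filter_upwards [hcont.eventually_ne hne, Metric.isOpen_ball.mem_nhds hc.center_mem]
      with w hw hwr
    obtain ⟨c, hc2, hcJ⟩ := h.J_eq_smul h' hf (κ w) (hN _) (hI _)
    rcases eq_or_eq_neg_of_sq_eq_sq c 1 (hc2.trans (one_pow 2).symm) with rfl | rfl
    · intro X; rw [hcJ, one_smul]
    · -- With the opposite sign the null curve `g + Ψ'` would be stationary in the first direction.
      refine absurd ?_ hw
      rw [hc.fderiv_comp h'.smooth_add hwr, h'.diff_add, hcJ, hc.J_fst h hf hwr, neg_smul,
        one_smul, add_neg_cancel, map_zero]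
  · rintro x ⟨w, hw, rfl⟩
    exact hw

/-- Local rigidity for surfaces whose paracomplex structures agree at the given point. -/
lemma exists_local_congruence_of_J_eq (h : IsLift f Ψ J) (h' : IsLift g Ψ' J') (hf : IsTimelike f)
    (hg : IsTimelike g) (hN : ∀ q, IsNonflatAt f q)
    (hI : ∀ q X Y, firstForm g q X Y = firstForm f q X Y) {p : M} (hp : ∀ X, J' p X = J p X) :
    ∃ (θ : ℝ) (A : Mink →ₗ[ℝ] Mink) (t : Mink), IsLorentzOrthogonal A ∧
      ∀ᶠ x in 𝓝 p, g x = A (assocMember f Ψ θ x) + t := by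
  obtain ⟨κ, w₀, r, hc, rfl, hJ, hcov⟩ := exists_isNullChart h hf p
    (eventually_J_eq h h' hf hg hN hI hp)
  have hu₀ : w₀.1 ∈ Metric.ball w₀.1 r := Metric.mem_ball_self hc.pos
  have hv₀ : w₀.2 ∈ Metric.ball w₀.2 r := Metric.mem_ball_self hc.pos
  have hPg : ∀ w ∈ Metric.ball w₀ r, J' (κ w) (coordField κ w (1, 0)) = coordField κ w (1, 0) :=
    fun w hw => by rw [hJ w hw, hc.J_fst h hf hw]
  have hQg : ∀ w ∈ Metric.ball w₀ r, J' (κ w) (coordField κ w (0, 1)) = -coordField κ w (0, 1) :=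
    fun w hw => by rw [hJ w hw, hc.J_snd h hf hw]
  have hbinf := hc.swap.infinite_directions h.neg hf (hN _)
  obtain ⟨θ, A, hA, hPA, hQA⟩ := exists_boost_of_lorentz_eq
    (a := fun u : Metric.ball w₀.1 r => fderiv ℝ ((f + Ψ) ∘ κ) (u, w₀.2) (1, 0))
    (a' := fun u : Metric.ball w₀.1 r => fderiv ℝ ((g + Ψ') ∘ κ) (u, w₀.2) (1, 0))
    (b := fun v : Metric.ball w₀.2 r => fderiv ℝ ((f + -Ψ) ∘ κ) (w₀.1, v) (0, 1))
    (b' := fun v : Metric.ball w₀.2 r => fderiv ℝ ((g + -Ψ') ∘ κ) (w₀.1, v) (0, 1))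
    (fun u => by
      have hw := mk_mem_ball (w₀ := w₀) u.2 hv₀
      rw [hc.fderiv_comp h.smooth_add hw]; exact hc.diff_add_time h hw (1, 0))
    (fun u => by
      rw [hc.fderiv_comp h.smooth_add (mk_mem_ball u.2 hv₀)]; exact h.null _ _)
    (hc.infinite_directions h hf (hN _))
    (by
      have e : (fun v : Metric.ball w₀.2 r => fderiv ℝ ((f + -Ψ) ∘ κ) (w₀.1, v) (0, 1)) =
          fun v : Metric.ball w₀.swap.1 r =>
            fderiv ℝ ((f + -Ψ) ∘ κ ∘ Prod.swap) (v, w₀.swap.2) (1, 0) := by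
        funext v
        rw [← Function.comp_assoc, fderiv_comp_swap]; rfl
      rw [e]
      refine span_eq_top_of_infinite_null hbinf ?_ ?_
      · rintro _ ⟨v, rfl⟩
        have hw : ((v : ℝ), w₀.swap.2) ∈ Metric.ball w₀.swap r := mk_mem_ball v.2 hu₀
        simp only
        rw [hc.swap.fderiv_comp h.neg.smooth_add hw]
        exact hc.swap.diff_add_time h.neg hw (1, 0)
      · rintro _ ⟨v, rfl⟩
        have hw : ((v : ℝ), w₀.swap.2) ∈ Metric.ball w₀.swap r := mk_mem_ball v.2 hu₀
        simp only
        rw [hc.swap.fderiv_comp h.neg.smooth_add hw]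
        exact h.neg.null _ _)
    (fun u => by
      rw [hc.fderiv_comp h'.smooth_add (mk_mem_ball u.2 hv₀)]; exact h'.null _ _)
    (fun u v => by
      have hw := mk_mem_ball (w₀ := w₀) u.2 v.2
      have hu := mk_mem_ball (w₀ := w₀) u.2 hv₀
      have hv := mk_mem_ball (w₀ := w₀) hu₀ v.2
      rw [hc.fderiv_fst_eq h hf h' hJ hu hw, hc.fderiv_snd_eq h hf h' hJ hv hw,
        hc.fderiv_fst_eq h hf h (fun _ _ _ => rfl) hu hw,
        hc.fderiv_snd_eq h hf h (fun _ _ _ => rfl) hv hw, hc.fderiv_comp h'.smooth_add hw,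
        hc.fderiv_comp h.smooth_add hw, hc.fderiv_comp h'.neg.smooth_add hw,
        hc.fderiv_comp h.neg.smooth_add hw, h'.lorentz_diff, h.lorentz_diff, hI, hJ _ hw, hJ _ hw])
  have hgu : ∀ w ∈ Metric.ball w₀ r, diff g (κ w) (coordField κ w (1, 0)) =
      Real.exp θ • A (diff f (κ w) (coordField κ w (1, 0))) := by
    rintro ⟨u, v⟩ hw
    have huv := hw
    rw [← ball_prod_same] at huv
    have e1 := hPA ⟨u, huv.1⟩
    have hu := mk_mem_ball (w₀ := w₀) huv.1 hv₀
    simp only at e1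
    rw [hc.fderiv_fst_eq h hf h' hJ hu hw, hc.fderiv_fst_eq h hf h (fun _ _ _ => rfl) hu hw,
      hc.fderiv_comp h'.smooth_add hw, hc.fderiv_comp h.smooth_add hw,
      diff_half_pos h' (hPg _ hw), diff_half_pos h (hc.J_fst h hf hw), map_smul, smul_comm] at e1
    exact smul_right_injective _ two_ne_zero e1
  have hgv : ∀ w ∈ Metric.ball w₀ r, diff g (κ w) (coordField κ w (0, 1)) =
      Real.exp (-θ) • A (diff f (κ w) (coordField κ w (0, 1))) := by
    rintro ⟨u, v⟩ hw
    have huv := hw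
    rw [← ball_prod_same] at huv
    have e1 := hQA ⟨v, huv.2⟩
    have hv := mk_mem_ball (w₀ := w₀) hu₀ huv.2
    simp only at e1
    rw [hc.fderiv_snd_eq h hf h' hJ hv hw, hc.fderiv_snd_eq h hf h (fun _ _ _ => rfl) hv hw,
      hc.fderiv_comp h'.neg.smooth_add hw, hc.fderiv_comp h.neg.smooth_add hw,
      diff_half_pos h'.neg (by rw [LinearMap.neg_apply, hQg _ hw, neg_neg]),
      diff_half_pos h.neg (by rw [LinearMap.neg_apply, hc.J_snd h hf hw, neg_neg]),
      map_smul, smul_comm] at e1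
    exact smul_right_injective _ two_ne_zero e1
  have hdiff : ∀ w ∈ Metric.ball w₀ r, ∀ X, diff g (κ w) X =
      A (diff (assocMember f Ψ θ) (κ w) X) := by
    intro w hw X
    rw [hc.eq_coordField h hf hw X, map_add, map_smul, map_smul, map_add, map_smul, map_smul,
      map_add, map_smul, map_smul, hgu w hw, hgv w hw,
      h.diff_assocMember_pos θ (hc.J_fst h hf hw), h.diff_assocMember_neg θ (hc.J_snd h hf hw),
      map_smul, map_smul]
  set F : M → Mink := fun q => (-A) (assocMember f Ψ θ q) + 0
  have hF : ∀ q, ContMDiffAt (𝓡 2) 𝓘(ℝ, Mink) ∞ F q := fun q =>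
    contMDiffAt_affine (h.smooth_assocMember θ q) (-A) 0
  refine ⟨θ, A, (g + F) (κ w₀), hA, ?_⟩
  have hzero : ∀ᶠ x in 𝓝 (κ w₀), MDifferentiableAt (𝓡 2) 𝓘(ℝ, Mink) (g + F) x ∧
      ∀ X, diff (g + F) x X = 0 := by
    filter_upwards [hcov _ (Metric.ball_mem_nhds w₀ hc.pos)]
    rintro _ ⟨w, hw, rfl⟩
    have hFd := (hF (κ w)).mdifferentiableAt (by simp)
    refine ⟨(h'.mdifferentiableAt _).add hFd, fun X => ?_⟩
    rw [TimelikeMinimal.diff_add (h'.mdifferentiableAt _) hFd, hdiff w hw,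
      diff_affine ((h.smooth_assocMember θ _).mdifferentiableAt (by simp)), LinearMap.neg_apply,
      add_neg_cancel]
  filter_upwards [eventually_eq_of_diff_eq_zero hzero] with x hx
  rw [← hx]
  simp [F]

/-- Local rigidity: near every point, a surface that is isometric to a surface `f` without flat
points is congruent to a member of the associated family of `f`. -/
lemma exists_local_congruence (h : IsLift f Ψ J) (h' : IsLift g Ψ' J') (hf : IsTimelike f)
    (hg : IsTimelike g) (hN : ∀ q, IsNonflatAt f q)
    (hI : ∀ q X Y, firstForm g q X Y = firstForm f q X Y) (p : M) :
    ∃ (θ : ℝ) (A : Mink →ₗ[ℝ] Mink) (t : Mink), IsLorentzOrthogonal A ∧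
      ∀ᶠ x in 𝓝 p, g x = A (assocMember f Ψ θ x) + t := by
  obtain ⟨c, hc2, hcJ⟩ := h.J_eq_smul h' hf p (hN _) (hI _)
  rcases eq_or_eq_neg_of_sq_eq_sq c 1 (hc2.trans (one_pow 2).symm) with rfl | rfl
  · exact exists_local_congruence_of_J_eq h h' hf hg hN hI fun X => by rw [hcJ, one_smul]
  · exact exists_local_congruence_of_J_eq h h'.neg hf hg hN hI fun X => by
      rw [LinearMap.neg_apply, hcJ, neg_smul, one_smul, neg_neg]

/-! ### Global rigidity -/

/-- Near every point, the tangent vectors of one of the two null directions span `ℝ³₁`. -/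
lemma span_diff_pos (h : IsLift f Ψ J) (hf : IsTimelike f) (hN : ∀ q, IsNonflatAt f q) {p : M}
    {V : Set M} (hV : V ∈ 𝓝 p) :
    Submodule.span ℝ {y | ∃ q ∈ V, ∃ X, J q X = X ∧ y = diff f q X} = ⊤ := by
  obtain ⟨κ, w₀, r, hc, rfl, hκV, -⟩ := exists_isNullChart h hf p hV
  have hv₀ : w₀.2 ∈ Metric.ball w₀.2 r := Metric.mem_ball_self hc.pos
  rw [eq_top_iff, ← span_eq_top_of_infinite_null (hc.infinite_directions h hf (hN _))]
  · refine Submodule.span_mono ?_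
    rintro _ ⟨u, rfl⟩
    have hw := mk_mem_ball (w₀ := w₀) u.2 hv₀
    refine ⟨_, hκV _ hw, (2 : ℝ) • coordField κ (u, w₀.2) (1, 0), ?_, ?_⟩
    · rw [map_smul, hc.J_fst h hf hw]
    · simp only
      rw [hc.fderiv_comp h.smooth_add hw, diff_half_pos h (hc.J_fst h hf hw), map_smul]
  · rintro _ ⟨u, rfl⟩
    have hw := mk_mem_ball (w₀ := w₀) u.2 hv₀
    simp only
    rw [hc.fderiv_comp h.smooth_add hw]; exact hc.diff_add_time h hw (1, 0)
  · rintro _ ⟨u, rfl⟩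
    simp only
    rw [hc.fderiv_comp h.smooth_add (mk_mem_ball u.2 hv₀)]; exact h.null _ _

/-- The parameter and the motion in a local congruence are unique. -/
lemma congruence_unique (h : IsLift f Ψ J) (hf : IsTimelike f) (hN : ∀ q, IsNonflatAt f q) {p : M}
    {θ θ' : ℝ} {A A' : Mink →ₗ[ℝ] Mink} {t t' : Mink} (hA' : IsLorentzOrthogonal A')
    (heq : ∀ᶠ x in 𝓝 p, A (assocMember f Ψ θ x) + t = A' (assocMember f Ψ θ' x) + t') :
    θ = θ' ∧ A = A' ∧ t = t' := by
  have hV := heq.eventually_nhds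
  have hd : ∀ q, (∀ᶠ x in 𝓝 q, A (assocMember f Ψ θ x) + t = A' (assocMember f Ψ θ' x) + t') →
      ∀ X, A (diff (assocMember f Ψ θ) q X) = A' (diff (assocMember f Ψ θ') q X) := by
    intro q hq X
    have e := DFunLike.congr_fun (diff_congr (f := fun x => A (assocMember f Ψ θ x) + t)
      (g := fun x => A' (assocMember f Ψ θ' x) + t') hq) X
    exact (diff_affine ((h.smooth_assocMember θ q).mdifferentiableAt (by simp)) A t X).symm.trans
      (e.trans (diff_affine ((h.smooth_assocMember θ' q).mdifferentiableAt (by simp)) A' t' X))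
  have h1 : Real.exp θ • A = Real.exp θ' • A' := by
    refine LinearMap.ext_on (span_diff_pos h hf hN hV) ?_
    rintro _ ⟨q, hq, X, hX, rfl⟩
    have := hd q hq X
    rw [h.diff_assocMember_pos θ hX, h.diff_assocMember_pos θ' hX, map_smul, map_smul] at this
    exact this
  have h2 : Real.exp (-θ) • A = Real.exp (-θ') • A' := by
    refine LinearMap.ext_on (span_diff_pos h.neg hf hN hV) ?_
    rintro _ ⟨q, hq, X, hX, rfl⟩
    have hX' : J q X = -X := neg_eq_iff_eq_neg.1 hX
    have := hd q hq X
    rw [h.diff_assocMember_neg θ hX', h.diff_assocMember_neg θ' hX', map_smul, map_smul] at this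
    exact this
  have e1 : A = Real.exp (θ' - θ) • A' := by
    rw [sub_eq_neg_add, Real.exp_add, mul_smul, ← h1, smul_smul, ← Real.exp_add, neg_add_cancel,
      Real.exp_zero, one_smul]
  have e2 : A = Real.exp (θ - θ') • A' := by
    rw [sub_eq_add_neg, Real.exp_add, mul_smul, ← h2, smul_smul, ← Real.exp_add, add_neg_cancel,
      Real.exp_zero, one_smul]
  have hθ : θ = θ' := by
    have h3 : A' ![0, 1, 0] ≠ 0 := fun h0 => by
      have := hA' ![0, 1, 0] ![0, 1, 0]
      rw [h0] at this
      simp [lorentz] at this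
    have h4 := LinearMap.congr_fun (e1.symm.trans e2) ![0, 1, 0]
    have h5 := Real.exp_injective (smul_left_injective ℝ h3 h4)
    linarith
  subst hθ
  have hAA : A = A' := by rw [e1, sub_self, Real.exp_zero, one_smul]
  subst hAA
  exact ⟨rfl, rfl, add_left_cancel heq.self_of_nhds⟩

/-- Rigidity: a surface that is isometric to a surface `f` without flat points is congruent to a
member of the associated family of `f`. -/
theorem exists_congruence [PreconnectedSpace M] [Nonempty M] (h : IsLift f Ψ J)
    (h' : IsLift g Ψ' J') (hf : IsTimelike f) (hg : IsTimelike g) (hN : ∀ q, IsNonflatAt f q)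
    (hI : ∀ q X Y, firstForm g q X Y = firstForm f q X Y) :
    ∃ (θ : ℝ) (A : Mink →ₗ[ℝ] Mink) (t : Mink), IsLorentzOrthogonal A ∧
      ∀ x, g x = A (assocMember f Ψ θ x) + t := by
  choose θ A t hA hloc using exists_local_congruence h h' hf hg hN hI
  have hconst : IsLocallyConstant fun x => (θ x, A x, t x) := by
    rw [IsLocallyConstant.iff_eventually_eq]
    intro x
    filter_upwards [(hloc x).eventually_nhds] with y hy
    obtain ⟨h1, h2, h3⟩ := congruence_unique h hf hN (hA x)
      ((hloc y).and hy |>.mono fun z hz => hz.1.symm.trans hz.2)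
    rw [h1, h2, h3]
  obtain ⟨x₀⟩ : Nonempty M := inferInstance
  refine ⟨θ x₀, A x₀, t x₀, hA x₀, fun x => ?_⟩
  have hx := hconst.apply_eq_of_preconnectedSpace x x₀
  simp only [Prod.mk.injEq] at hx
  have := (hloc x).self_of_nhds
  rwa [hx.1, hx.2.1, hx.2.2] at this

end Rigidity

/-! ### Surfaces identified by a diffeomorphism -/

section Transport

variable {M : Type*} [TopologicalSpace M] [ChartedSpace Plane M]
  {N : Type*} [TopologicalSpace N] [ChartedSpace Plane N]
  {f Ψ : N → Mink} {J : ∀ p : N, TangentSpace (𝓡 2) p →ₗ[ℝ] TangentSpace (𝓡 2) p}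

/-- The differential of a diffeomorphism. -/
noncomputable def diffEquiv (σ : M ≃ₘ⟮𝓡 2, 𝓡 2⟯ N) (p : M) :
    TangentSpace (𝓡 2) p ≃L[ℝ] TangentSpace (𝓡 2) (σ p) :=
  σ.mfderivToContinuousLinearEquiv (by simp) p

lemma diff_comp_diffeomorph {g : N → Mink} (σ : M ≃ₘ⟮𝓡 2, 𝓡 2⟯ N) {p : M}
    (hg : ContMDiffAt (𝓡 2) 𝓘(ℝ, Mink) ∞ g (σ p)) (X : TangentSpace (𝓡 2) p) :
    diff (g ∘ σ) p X = diff g (σ p) (diffEquiv σ p X) :=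
  diff_comp (hg.mdifferentiableAt (by simp)) (σ.contMDiff.contMDiffAt.mdifferentiableAt (by simp)) X

lemma firstForm_comp_diffeomorph {g : N → Mink} (σ : M ≃ₘ⟮𝓡 2, 𝓡 2⟯ N)
    (hg : ContMDiff (𝓡 2) 𝓘(ℝ, Mink) ∞ g) (p : M) (X Y : TangentSpace (𝓡 2) p) :
    firstForm (g ∘ σ) p X Y = firstForm g (σ p) (diffEquiv σ p X) (diffEquiv σ p Y) := by
  simp only [firstForm, diff_comp_diffeomorph σ hg.contMDiffAt]

lemma IsTimelike.comp_diffeomorph (hf : IsTimelike f) (σ : M ≃ₘ⟮𝓡 2, 𝓡 2⟯ N) :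
    IsTimelike (f ∘ σ) := by
  refine ⟨hf.1.comp σ.contMDiff, fun p => ?_⟩
  obtain ⟨⟨X, hX⟩, ⟨Y, hY⟩⟩ := hf.2 (σ p)
  refine ⟨⟨(diffEquiv σ p).symm X, ?_⟩, ⟨(diffEquiv σ p).symm Y, ?_⟩⟩ <;>
    rw [firstForm_comp_diffeomorph σ hf.1] <;> simpa

lemma IsNonflatAt.comp_diffeomorph (hf : ContMDiff (𝓡 2) 𝓘(ℝ, Mink) ∞ f)
    (σ : M ≃ₘ⟮𝓡 2, 𝓡 2⟯ N) {p : M} (hN : IsNonflatAt f (σ p)) : IsNonflatAt (f ∘ σ) p := by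
  obtain ⟨ν, hν, hn, hinj⟩ := hN
  refine ⟨ν ∘ σ, hν.comp p σ.contMDiff.contMDiffAt, ?_, ?_⟩
  · filter_upwards [(σ.continuous.continuousAt (x := p)).eventually hn] with q hq
    exact ⟨hq.1, fun X => by rw [diff_comp_diffeomorph σ hf.contMDiffAt]; exact hq.2 _⟩
  · refine (injective_iff_map_eq_zero _).2 fun X hX => ?_
    rw [diff_comp_diffeomorph σ hν] at hX
    exact (map_eq_zero_iff _ (diffEquiv σ p).injective).1
      ((injective_iff_map_eq_zero _).1 hinj _ hX)

lemma IsLift.comp_diffeomorph (h : IsLift f Ψ J) (σ : M ≃ₘ⟮𝓡 2, 𝓡 2⟯ N) :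
    IsLift (f ∘ σ) (Ψ ∘ σ) fun p => (diffEquiv σ p).symm.toLinearEquiv.toLinearMap ∘ₗ J (σ p) ∘ₗ
      (diffEquiv σ p).toLinearEquiv.toLinearMap := by
  refine ⟨h.smooth.comp σ.contMDiff, h.smooth_im.comp σ.contMDiff, fun p X => ⟨?_, fun Y => ?_⟩,
    fun p X => ?_, fun p X => ?_⟩
  · simp [(h.structure_re (σ p) _).1]
  · rw [firstForm_comp_diffeomorph σ h.smooth, firstForm_comp_diffeomorph σ h.smooth]
    simp [(h.structure_re (σ p) _).2]
  · rw [diff_comp_diffeomorph σ h.smooth.contMDiffAt,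
      diff_comp_diffeomorph σ h.smooth_im.contMDiffAt]
    simp [h.diff_J]
  · rw [diff_comp_diffeomorph σ h.smooth.contMDiffAt,
      diff_comp_diffeomorph σ h.smooth_im.contMDiffAt]
    simp [h.diff_im_J]

/-- Rigidity for surfaces on different manifolds, identified by a diffeomorphism. -/
theorem exists_congruentVia [IsManifold (𝓡 2) ∞ M] [SimplyConnectedSpace M] {f₁ : M → Mink}
    (h₁ : IsTimelikeMinimal f₁) (h : IsLift f Ψ J) (hf : IsTimelike f)
    (hN : ∀ q, IsNonflatAt f q) {σ : M ≃ₘ⟮𝓡 2, 𝓡 2⟯ N} (hσ : IsIsometry σ f₁ f) :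
    ∃ θ : ℝ, CongruentVia σ f₁ (assocMember f Ψ θ) := by
  obtain ⟨Ψ₁, J₁, hL₁⟩ := exists_isLift h₁
  obtain ⟨θ, A, t, hA, hx⟩ := exists_congruence (h.comp_diffeomorph σ) hL₁ (hf.comp_diffeomorph σ)
    h₁.1 (fun q => (hN (σ q)).comp_diffeomorph h.smooth σ) fun p X Y => by
      rw [firstForm_comp_diffeomorph σ h.smooth]; exact hσ p X Y
  exact ⟨θ, A, t, hA, hx⟩

lemma IsLift.exists_isAssociatedFamily (h : IsLift f Ψ J) : ∃ F, IsAssociatedFamily f F :=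
  ⟨_, _, h.isParaholomorphicLift, fun _ => rfl⟩

lemma IsAssociatedFamily.exists_isLift {F : ℝ → N → Mink} (hF : IsAssociatedFamily f F) :
    ∃ Ψ J, IsLift f Ψ J ∧ ∀ θ, F θ = assocMember f Ψ θ := by
  obtain ⟨Φ, hΦ, hF⟩ := hF
  obtain ⟨J, hJ⟩ := hΦ.exists_isLift
  refine ⟨_, J, hJ, fun θ => ?_⟩
  rw [hF, rePart_paraExp_smul, hΦ.2]; rfl

lemma IsConjugateSurface.exists_isLift {g : N → Mink} (hg : IsConjugateSurface f g) :
    ∃ J, IsLift f g J := by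
  obtain ⟨Φ, hΦ, rfl⟩ := hg
  rw [rePart_paraJ_smul]
  exact hΦ.exists_isLift

end Transport

/-! ### Ruled surfaces with a constant null director -/

section Ruled

/-- The ruled surface `φ(u) + v B`. Both flat examples are of this form with `B = (1, 0, 1)`. -/
def ruled (φ : ℝ → Mink) (B : Mink) (z : Plane) : Mink := φ (z 0) + z 1 • B

lemma contMDiff_ruled {φ : ℝ → Mink} (hφ : ContDiff ℝ ∞ φ) (B : Mink) :
    ContMDiff (𝓡 2) 𝓘(ℝ, Mink) ∞ (ruled φ B) := by
  let π₀ : Plane →L[ℝ] ℝ := EuclideanSpace.proj 0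
  let π₁ : Plane →L[ℝ] ℝ := EuclideanSpace.proj 1
  exact ((hφ.comp π₀.contDiff).add (π₁.contDiff.smul contDiff_const)).contMDiff

lemma diff_ruled {φ : ℝ → Mink} {B φ' : Mink} {z : Plane} (hφ : HasDerivAt φ φ' (z 0)) (X : Plane) :
    diff (ruled φ B) z X = X 0 • φ' + X 1 • B := by
  let π₀ : Plane →L[ℝ] ℝ := EuclideanSpace.proj 0
  let π₁ : Plane →L[ℝ] ℝ := EuclideanSpace.proj 1
  have h : HasFDerivAt (ruled φ B) (((1 : ℝ →L[ℝ] ℝ).smulRight φ').comp π₀ + π₁.smulRight B) z :=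
    (HasFDerivAt.comp z (g := φ) (f := π₀) hφ.hasFDerivAt π₀.hasFDerivAt).add
      (π₁.hasFDerivAt.smul_const B)
  refine (diff_eq_fderiv _ z X).trans ?_
  rw [h.fderiv]
  simp [π₀, π₁]

/-- The endomorphism `∂u ↦ k ∂v`, `∂v ↦ 0` of the parameter plane. -/
noncomputable def shear (k : ℝ) : Plane →ₗ[ℝ] Plane :=
  (EuclideanSpace.proj (𝕜 := ℝ) (0 : Fin 2)).toLinearMap.smulRight (EuclideanSpace.single 1 k)

lemma shear_zero_coord (k : ℝ) (X : Plane) : shear k X 0 = 0 := by simp [shear]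

lemma shear_one_coord (k : ℝ) (X : Plane) : shear k X 1 = X 0 * k := by simp [shear]

lemma shear_sq (k : ℝ) : shear k * shear k = 0 := by
  ext X i; fin_cases i <;> simp [shear]

lemma trace_shear (k : ℝ) : LinearMap.trace ℝ Plane (shear k) = 0 :=
  (LinearMap.isNilpotent_trace_of_isNilpotent ⟨2, by rw [sq, shear_sq]⟩).eq_zero

lemma det_shear (k : ℝ) : LinearMap.det (shear k) = 0 := by
  have h := congrArg LinearMap.det (shear_sq k)
  rw [map_mul, LinearMap.det_zero''] at h
  exact mul_self_eq_zero.1 h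

/-- A nonzero endomorphism with square zero has no complex eigenbasis. -/
lemma not_exists_eigenbasis {V : Type*} [AddCommGroup V] [Module ℝ V] {S : V →ₗ[ℝ] V}
    (hS2 : ∀ X, S (S X) = 0) (hS : S ≠ 0) :
    ¬ ∃ b : Module.Basis (Fin 2) ℂ (TensorProduct ℝ ℂ V),
      ∀ i, ∃ c : ℂ, S.baseChange ℂ (b i) = c • b i := by
  rintro ⟨b, hb⟩
  have hsq : S.baseChange ℂ ∘ₗ S.baseChange ℂ = 0 := by
    rw [← LinearMap.baseChange_comp, show S ∘ₗ S = 0 from LinearMap.ext hS2,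
      LinearMap.baseChange_zero]
  have h0 : S.baseChange ℂ = 0 := by
    refine b.ext fun i => ?_
    obtain ⟨c, hc⟩ := hb i
    have h1 := LinearMap.congr_fun hsq (b i)
    rw [LinearMap.comp_apply, hc, map_smul, hc, smul_smul, LinearMap.zero_apply] at h1
    have hcc := (smul_eq_zero.1 h1).resolve_right (b.ne_zero i)
    rw [hc, mul_self_eq_zero.1 hcc, zero_smul, LinearMap.zero_apply]
  refine hS (LinearMap.ext fun X => ?_)
  have h1 := LinearMap.congr_fun h0 ((1 : ℂ) ⊗ₜ[ℝ] X)
  rw [LinearMap.baseChange_tmul, LinearMap.zero_apply] at h1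
  have h2 := congrArg ((TensorProduct.lid ℝ V).toLinearMap ∘ₗ LinearMap.rTensor V Complex.reLm) h1
  simpa using h2

variable {φ φ' n : ℝ → Mink} {B : Mink} {c : ℝ → ℝ}

/-- The data of a flat ruled surface: `φ'` is the derivative of the base curve `φ`, both `φ'` and
the director `B` are null, `n` is the unit normal and `n' = c B`. The shape operator is then the
nilpotent map `∂u ↦ -c ∂v`, `∂v ↦ 0`, so that the surface is minimal and flat; it is umbilic where
`c = 0` and quasi-umbilic elsewhere. The pairing prescribes the first fundamental form
`3 e^u du dv`. -/
structure IsFlatRuled (φ φ' n : ℝ → Mink) (B : Mink) (c : ℝ → ℝ) : Prop where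
  smooth : ContDiff ℝ ∞ φ
  deriv_eq : ∀ u, HasDerivAt φ (φ' u) u
  smooth_normal : ContDiff ℝ ∞ n
  deriv_normal : ∀ u, HasDerivAt n (c u • B) u
  null : ∀ u, lorentz (φ' u) (φ' u) = 0
  null_director : lorentz B B = 0
  pairing : ∀ u, lorentz (φ' u) B = 3 / 2 * Real.exp u
  unit : ∀ u, lorentz (n u) (n u) = 1
  normal_base : ∀ u, lorentz (n u) (φ' u) = 0
  normal_director : ∀ u, lorentz (n u) B = 0

namespace IsFlatRuled

lemma diff_eq (h : IsFlatRuled φ φ' n B c) (z X : Plane) :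
    diff (ruled φ B) z X = X 0 • φ' (z 0) + X 1 • B := diff_ruled (h.deriv_eq _) X

lemma firstForm_eq (h : IsFlatRuled φ φ' n B c) (z X Y : Plane) :
    firstForm (ruled φ B) z X Y = 3 * Real.exp (z 0) * ((X 0 * Y 1 + X 1 * Y 0) / 2) := by
  simp only [firstForm]
  rw [h.diff_eq z X, h.diff_eq z Y]
  simp only [lorentz_add_left, lorentz_add_right, lorentz_smul_left, lorentz_smul_right, h.null,
    h.null_director, lorentz_comm B, h.pairing]
  ring

lemma lorentz_normal_diff (h : IsFlatRuled φ φ' n B c) (z X : Plane) :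
    lorentz (n (z 0)) (diff (ruled φ B) z X) = 0 := by
  refine (congrArg (lorentz (n (z 0))) (h.diff_eq z X)).trans ?_
  rw [lorentz_add_right, lorentz_smul_right, lorentz_smul_right, h.normal_base,
    h.normal_director, mul_zero, mul_zero, add_zero]

lemma isTimelike (h : IsFlatRuled φ φ' n B c) : IsTimelike (ruled φ B) := by
  refine ⟨contMDiff_ruled h.smooth B, fun z => ⟨⟨(!₂[1, -1] : Plane), ?_⟩,
    ⟨(!₂[1, 1] : Plane), ?_⟩⟩⟩
  · rw [h.firstForm_eq z !₂[1, -1] !₂[1, -1]]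
    have := Real.exp_pos (z 0)
    simp; linarith
  · rw [h.firstForm_eq z !₂[1, 1] !₂[1, 1]]
    have := Real.exp_pos (z 0)
    simp; linarith

lemma isShapeOperator (h : IsFlatRuled φ φ' n B c) (z : Plane) :
    IsShapeOperator (ruled φ B) z (shear (-c (z 0))) := by
  refine ⟨ruled n 0, (contMDiff_ruled h.smooth_normal 0).contMDiffAt,
    Filter.Eventually.of_forall fun q => ?_, fun X => ?_⟩
  · have hq : ruled n 0 q = n (q 0) := by simp [ruled]
    rw [hq]
    exact ⟨h.unit _, h.lorentz_normal_diff q⟩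
  · have e : ∀ X : Plane, X 0 • c (z 0) • B + X 1 • (0 : Mink) =
        -(shear (-c (z 0)) X 0 • φ' (z 0) + shear (-c (z 0)) X 1 • B) := fun X => by
      rw [shear_zero_coord, shear_one_coord]
      module
    exact (diff_ruled (h.deriv_normal (z 0)) X).trans
      ((e X).trans (congrArg Neg.neg (h.diff_eq z (shear (-c (z 0)) X))).symm)

lemma isTimelikeMinimal (h : IsFlatRuled φ φ' n B c) : IsTimelikeMinimal (ruled φ B) :=
  ⟨h.isTimelike, fun z => ⟨_, h.isShapeOperator z, by
    have : LinearMap.trace ℝ (TangentSpace (𝓡 2) z) (shear (-c (z 0))) = 0 := trace_shear _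
    rw [this, mul_zero]⟩⟩

lemma isFlatPoint (h : IsFlatRuled φ φ' n B c) (z : Plane) : IsFlatPoint (ruled φ B) z :=
  ⟨_, h.isShapeOperator z, (det_shear _).symm⟩

lemma isUmbilic (h : IsFlatRuled φ φ' n B c) {z : Plane} (hc : c (z 0) = 0) :
    IsUmbilic (ruled φ B) z := by
  refine ⟨_, h.isShapeOperator z, 0, ?_⟩
  rw [hc, zero_smul, shear, neg_zero]
  refine LinearMap.ext fun X => ?_
  change X.ofLp 0 • EuclideanSpace.single (1 : Fin 2) (0 : ℝ) = 0
  simp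

lemma isQuasiUmbilic (h : IsFlatRuled φ φ' n B c) {z : Plane} (hc : c (z 0) ≠ 0) :
    IsQuasiUmbilic (ruled φ B) z := by
  refine ⟨_, h.isShapeOperator z, not_exists_eigenbasis (V := TangentSpace (𝓡 2) z)
    (fun X => LinearMap.congr_fun (shear_sq _) X) fun h0 => ?_⟩
  have h1 : shear (-c (z 0)) !₂[1, 0] 1 = 0 := congrArg (fun X : Plane => X 1)
    (LinearMap.congr_fun h0 (!₂[1, 0] : Plane))
  rw [shear_one_coord] at h1
  simp at h1
  exact hc h1

/-- The conjugate surface of `φ(u) + v B` is `φ(u) - v B`. -/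
lemma exists_isAssociatedFamily (h : IsFlatRuled φ φ' n B c) :
    ∃ F, IsAssociatedFamily (ruled φ B) F := by
  let J : Plane →ₗ[ℝ] Plane :=
    { toFun := fun X => !₂[X 0, -X 1]
      map_add' := fun X Y => by ext i; fin_cases i <;> simp; ring
      map_smul' := fun k X => by ext i; fin_cases i <;> simp }
  have hJ0 : ∀ X, J X 0 = X 0 := fun X => rfl
  have hJ1 : ∀ X, J X 1 = -X 1 := fun X => rfl
  have hΨ : ∀ z X : Plane, diff (ruled φ (-B)) z X = X 0 • φ' (z 0) + X 1 • -B := fun z X =>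
    diff_ruled (h.deriv_eq _) X
  have hJ : ∀ X, J (J X) = X := fun X => by
    ext i
    fin_cases i
    · rfl
    · exact neg_neg _
  have hI : ∀ z X Y : Plane,
      firstForm (ruled φ B) z (J X) (J Y) = -firstForm (ruled φ B) z X Y := fun z X Y => by
    rw [h.firstForm_eq z (J X) (J Y), h.firstForm_eq z X Y, hJ0, hJ1, hJ0, hJ1]; ring
  have hd : ∀ z X : Plane, diff (ruled φ B) z (J X) = diff (ruled φ (-B)) z X := fun z X => by
    rw [h.diff_eq z (J X), hΨ z X, hJ0, hJ1]; module
  have hd' : ∀ z X : Plane, diff (ruled φ (-B)) z (J X) = diff (ruled φ B) z X := fun z X => by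
    rw [h.diff_eq z X, hΨ z (J X), hJ0, hJ1]; module
  have hL : IsLift (ruled φ B) (ruled φ (-B)) fun _ => J :=
    ⟨contMDiff_ruled h.smooth _, contMDiff_ruled h.smooth _, fun z X => ⟨hJ X, hI z X⟩, hd, hd'⟩
  exact hL.exists_isAssociatedFamily

end IsFlatRuled

/-! ### The two flat examples -/

lemma planeExample_eq : planeExample =
    ruled (fun u => (Real.exp u / 2) • ![-2, Real.sqrt 3, 1]) ![1, 0, 1] := by
  funext z; funext i
  fin_cases i <;> simp [planeExample, ruled] <;> ring

/-- The unit normal of the plane that contains `planeExample`. -/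
noncomputable def planeNormal : Mink := ![-(Real.sqrt 3 / 3), 1, -(Real.sqrt 3 / 3)]

lemma sqrt_three_mul_self : Real.sqrt 3 * Real.sqrt 3 = 3 := Real.mul_self_sqrt (by norm_num)

lemma isFlatRuled_planeExample : IsFlatRuled (fun u => (Real.exp u / 2) • ![-2, Real.sqrt 3, 1])
    (fun u => (Real.exp u / 2) • ![-2, Real.sqrt 3, 1]) (fun _ => planeNormal) ![1, 0, 1]
    (fun _ => 0) := by
  have h3 := sqrt_three_mul_self
  refine ⟨(Real.contDiff_exp.div_const 2).smul contDiff_const, fun u =>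
    ((Real.hasDerivAt_exp u).div_const 2).smul_const _, contDiff_const, fun u => ?_, fun u => ?_,
    ?_, fun u => ?_, fun u => ?_, fun u => ?_, fun u => ?_⟩
  · rw [zero_smul]; exact hasDerivAt_const _ _
  · rw [lorentz_smul_left, lorentz_smul_right]; simp [lorentz, h3]; norm_num
  · simp [lorentz]
  · rw [lorentz_smul_left]; simp [lorentz]; ring
  · simp [lorentz, planeNormal]
  · rw [lorentz_smul_right]; simp [lorentz, planeNormal]; ring
  · simp [lorentz, planeNormal]

lemma scrollExample_eq : scrollExample =
    ruled (fun u => ![-u - 3 / 4 * Real.exp u, 2 * Real.sqrt 3 * Real.exp (u / 2),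
      -u + 3 / 4 * Real.exp u]) ![1, 0, 1] := by
  funext z; funext i
  fin_cases i <;> simp [scrollExample, ruled]

lemma isFlatRuled_scrollExample :
    IsFlatRuled (fun u => ![-u - 3 / 4 * Real.exp u, 2 * Real.sqrt 3 * Real.exp (u / 2),
        -u + 3 / 4 * Real.exp u])
      (fun u => ![-1 - 3 / 4 * Real.exp u, Real.sqrt 3 * Real.exp (u / 2),
        -1 + 3 / 4 * Real.exp u])
      (fun u => ![-(2 * Real.sqrt 3 / 3 * Real.exp (-u / 2)), 1,
        -(2 * Real.sqrt 3 / 3 * Real.exp (-u / 2))]) ![1, 0, 1]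
      (fun u => Real.sqrt 3 / 3 * Real.exp (-u / 2)) := by
  have h3 := sqrt_three_mul_self
  have hh : ∀ u : ℝ, Real.exp (u / 2) * Real.exp (u / 2) = Real.exp u := fun u => by
    rw [← Real.exp_add, add_halves]
  have hm : ∀ u : ℝ, Real.exp (-u / 2) * Real.exp u = Real.exp (u / 2) := fun u => by
    rw [← Real.exp_add]; ring_nf
  have hd : ∀ u : ℝ, HasDerivAt (fun u : ℝ => Real.exp (u / 2)) (Real.exp (u / 2) * (1 / 2)) u :=
    fun u => ((hasDerivAt_id u).div_const 2).exp
  have hd' : ∀ u : ℝ, HasDerivAt (fun u : ℝ => Real.exp (-u / 2))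
      (Real.exp (-u / 2) * (-1 / 2)) u := fun u => ((hasDerivAt_id u).neg.div_const 2).exp
  refine ⟨?_, fun u => ?_, ?_, fun u => ?_, fun u => ?_, ?_, fun u => ?_, fun u => ?_, fun u => ?_,
    fun u => ?_⟩
  · refine contDiff_pi.2 fun i => ?_
    fin_cases i <;> simp <;> fun_prop
  · refine hasDerivAt_pi.2 fun i => ?_
    fin_cases i
    · exact (hasDerivAt_id u).neg.sub ((Real.hasDerivAt_exp u).const_mul _)
    · exact ((hd u).const_mul (2 * Real.sqrt 3)).congr_deriv (by simp; ring)
    · exact (hasDerivAt_id u).neg.add ((Real.hasDerivAt_exp u).const_mul _)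
  · refine contDiff_pi.2 fun i => ?_
    fin_cases i <;> simp <;> fun_prop
  · refine hasDerivAt_pi.2 fun i => ?_
    fin_cases i
    · exact ((hd' u).const_mul (2 * Real.sqrt 3 / 3)).neg.congr_deriv (by simp; ring)
    · exact (hasDerivAt_const u (1 : ℝ)).congr_deriv (by simp)
    · exact ((hd' u).const_mul (2 * Real.sqrt 3 / 3)).neg.congr_deriv (by simp; ring)
  · simp only [lorentz, Matrix.cons_val]
    linear_combination Real.exp (u / 2) * Real.exp (u / 2) * h3 + 3 * hh u
  · simp [lorentz]
  · simp [lorentz]; ring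
  · simp [lorentz]
  · simp only [lorentz, Matrix.cons_val]
    linear_combination (-Real.sqrt 3) * hm u
  · simp [lorentz]

lemma liesInTimelikePlane_planeExample : LiesInTimelikePlane planeExample := by
  refine ⟨planeNormal, 0, isFlatRuled_planeExample.unit 0, fun z => ?_⟩
  simp [lorentz, planeNormal, planeExample]; ring

lemma isBScroll_scrollExample : IsBScroll scrollExample := by
  have h := isFlatRuled_scrollExample
  refine ⟨_, fun _ => ![1, 0, 1], h.smooth, contDiff_const, fun u => ?_, fun u => ⟨?_,
    h.null_director⟩, fun z => congrFun scrollExample_eq z⟩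
  · rw [(h.deriv_eq u).deriv]
    refine ⟨fun h0 => ?_, h.null u⟩
    have := h.pairing u
    rw [h0] at this
    have hpos := Real.exp_pos u
    simp [lorentz] at this
  · intro h0
    have := congrFun h0 0
    simp at this

/-- The members of the associated family of a surface in a plane lie in parallel planes. -/
lemma lorentz_assocMember_const {f Ψ : Plane → Mink}
    {J : ∀ p : Plane, TangentSpace (𝓡 2) p →ₗ[ℝ] TangentSpace (𝓡 2) p} (h : IsLift f Ψ J) {n : Mink}
    (hn : ∀ z X, lorentz n (diff f z X) = 0) (θ : ℝ) :
    ∃ k, ∀ z, lorentz n (assocMember f Ψ θ z) = k := by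
  let l : Mink →L[ℝ] ℝ := LinearMap.toContinuousLinearMap (lorentzForm n)
  have hd : ∀ z, DifferentiableAt ℝ (assocMember f Ψ θ) z := fun z =>
    ((h.smooth_assocMember θ z).mdifferentiableAt (by simp)).differentiableAt
  have hl : ∀ z, HasFDerivAt (l ∘ assocMember f Ψ θ) (l.comp (fderiv ℝ (assocMember f Ψ θ) z)) z :=
    fun z => l.hasFDerivAt.comp z (hd z).hasFDerivAt
  refine ⟨lorentz n (assocMember f Ψ θ 0), fun z => ?_⟩
  refine is_const_of_fderiv_eq_zero (𝕜 := ℝ) (f := l ∘ assocMember f Ψ θ)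
    (fun z => (hl z).differentiableAt) (fun z => ?_) z 0
  rw [(hl z).fderiv]
  ext1 X
  have e : fderiv ℝ (assocMember f Ψ θ) z X =
      Real.cosh θ • diff f z X + Real.sinh θ • diff f z (J z X) :=
    (diff_eq_fderiv _ z X).symm.trans (h.diff_assocMember θ z X)
  change lorentz n (fderiv ℝ (assocMember f Ψ θ) z X) = 0
  rw [e, lorentz_add_right, lorentz_smul_right, lorentz_smul_right]
  linear_combination Real.cosh θ * hn z X + Real.sinh θ * hn z (J z X)

/-- The scroll is not contained in a plane. -/
lemma eq_zero_of_lorentz_scrollExample {m : Mink} {k : ℝ}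
    (h : ∀ z, lorentz m (scrollExample z) = k) : m = 0 := by
  -- Evaluation at points where `e^u` and `e^{u/2}` are integers gives linear equations for `m`.
  have h1 := h !₂[0, 0]
  have h2 := h !₂[0, 1]
  have h3 := h !₂[2 * Real.log 2, 0]
  have h4 := h !₂[2 * Real.log 3, 0]
  have e2 : Real.exp (2 * Real.log 2) = 4 := by
    rw [two_mul, Real.exp_add, Real.exp_log (by norm_num)]; norm_num
  have e3 : Real.exp (2 * Real.log 3) = 9 := by
    rw [two_mul, Real.exp_add, Real.exp_log (by norm_num)]; norm_num
  have e2' : Real.exp (2 * Real.log 2 / 2) = 2 := by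
    rw [mul_div_cancel_left₀ _ (two_ne_zero), Real.exp_log (by norm_num)]
  have e3' : Real.exp (2 * Real.log 3 / 2) = 3 := by
    rw [mul_div_cancel_left₀ _ (two_ne_zero), Real.exp_log (by norm_num)]
  simp only [lorentz, scrollExample, Matrix.cons_val, e2, e3, e2', e3', zero_div,
    Real.exp_zero] at h1 h2 h3 h4
  have m02 : m 2 = m 0 := by linarith
  rw [m02] at h1 h2 h3 h4
  have m0 : m 0 = 0 := by linarith
  rw [m0] at h1 h3
  have m1 : m 1 * Real.sqrt 3 = 0 := by linarith
  have m1' : m 1 = 0 := (mul_eq_zero.1 m1).resolve_right (by positivity)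
  ext i; fin_cases i <;> simp [m0, m1', m02]

/-- All members of the associated family of the planar surface are planar, the scroll is not. -/
lemma not_congruent_scrollExample {F : ℝ → Plane → Mink} (hF : IsAssociatedFamily planeExample F)
    (θ : ℝ) : ¬ Congruent scrollExample (F θ) := by
  rintro ⟨σ, A, t, hA, hx⟩
  obtain ⟨Ψ, J, hL, hFθ⟩ := hF.exists_isLift
  have hn : ∀ z X, lorentz planeNormal (diff planeExample z X) = 0 := by
    intro z X
    rw [planeExample_eq]
    exact isFlatRuled_planeExample.lorentz_normal_diff z X
  obtain ⟨k, hk⟩ := lorentz_assocMember_const hL hn θ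
  have h0 := eq_zero_of_lorentz_scrollExample (m := A planeNormal)
    (k := k + lorentz (A planeNormal) t) fun z => by
      rw [hx, lorentz_add_right, hA, hFθ, hk]
  have h1 := hA planeNormal planeNormal
  rw [h0, isFlatRuled_planeExample.unit 0] at h1
  simp [lorentz] at h1

end Ruled

end TimelikeMinimal

theorem theorem1p1 :
    -- two flat isometric surfaces that are not related through the associated family
    ((TimelikeMinimal.IsTimelikeMinimal TimelikeMinimal.planeExample ∧
        TimelikeMinimal.IsTimelikeMinimal TimelikeMinimal.scrollExample) ∧
      (∀ z, TimelikeMinimal.IsFlatPoint TimelikeMinimal.planeExample z ∧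
        TimelikeMinimal.IsFlatPoint TimelikeMinimal.scrollExample z) ∧
      (TimelikeMinimal.LiesInTimelikePlane TimelikeMinimal.planeExample ∧
        ∀ z, TimelikeMinimal.IsUmbilic TimelikeMinimal.planeExample z) ∧
      (TimelikeMinimal.IsBScroll TimelikeMinimal.scrollExample ∧
        ∀ z, TimelikeMinimal.IsQuasiUmbilic TimelikeMinimal.scrollExample z) ∧
      (∀ z X Y : TimelikeMinimal.Plane,
        TimelikeMinimal.firstForm TimelikeMinimal.planeExample z X Y =
            3 * Real.exp (z 0) * ((X 0 * Y 1 + X 1 * Y 0) / 2) ∧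
          TimelikeMinimal.firstForm TimelikeMinimal.scrollExample z X Y =
            3 * Real.exp (z 0) * ((X 0 * Y 1 + X 1 * Y 0) / 2)) ∧
      TimelikeMinimal.IsIsometry (Diffeomorph.refl (𝓡 2) TimelikeMinimal.Plane ∞)
        TimelikeMinimal.planeExample TimelikeMinimal.scrollExample ∧
      (∃ F, TimelikeMinimal.IsAssociatedFamily TimelikeMinimal.planeExample F) ∧
      ∀ F, TimelikeMinimal.IsAssociatedFamily TimelikeMinimal.planeExample F →
        ∀ θ : ℝ, ¬ TimelikeMinimal.Congruent TimelikeMinimal.scrollExample (F θ)) ∧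
    -- rigidity of simply connected surfaces without flat points
    ∀ {M₁ M₂ : Type*}
      [TopologicalSpace M₁] [ChartedSpace TimelikeMinimal.Plane M₁] [IsManifold (𝓡 2) ∞ M₁]
      [T2Space M₁] [SecondCountableTopology M₁] [SimplyConnectedSpace M₁]
      [TopologicalSpace M₂] [ChartedSpace TimelikeMinimal.Plane M₂] [IsManifold (𝓡 2) ∞ M₂]
      [T2Space M₂] [SecondCountableTopology M₂] [SimplyConnectedSpace M₂]
      (f₁ : M₁ → TimelikeMinimal.Mink) (f₂ : M₂ → TimelikeMinimal.Mink),
      TimelikeMinimal.IsTimelikeMinimal f₁ → TimelikeMinimal.IsTimelikeMinimal f₂ →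
      (∀ p, ¬ TimelikeMinimal.IsFlatPoint f₁ p) → (∀ p, ¬ TimelikeMinimal.IsFlatPoint f₂ p) →
      ∀ σ : M₁ ≃ₘ⟮𝓡 2, 𝓡 2⟯ M₂,
        (TimelikeMinimal.IsIsometry σ f₁ f₂ →
          (∃ F, TimelikeMinimal.IsAssociatedFamily f₂ F) ∧
          ∀ F, TimelikeMinimal.IsAssociatedFamily f₂ F →
            ∃ θ : ℝ, TimelikeMinimal.CongruentVia σ f₁ (F θ)) ∧
        (TimelikeMinimal.IsAntiIsometry σ f₁ f₂ →
          (∃ g, TimelikeMinimal.IsConjugateSurface f₂ g) ∧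
          ∀ g, TimelikeMinimal.IsConjugateSurface f₂ g →
            (∃ F, TimelikeMinimal.IsAssociatedFamily g F) ∧
            ∀ F, TimelikeMinimal.IsAssociatedFamily g F →
              ∃ θ : ℝ, TimelikeMinimal.CongruentVia σ f₁ (F θ)) := by
  refine ⟨?_, ?_⟩
  · have hp := TimelikeMinimal.isFlatRuled_planeExample
    have hb := TimelikeMinimal.isFlatRuled_scrollExample
    have hI : ∀ z X Y : TimelikeMinimal.Plane,
        TimelikeMinimal.firstForm TimelikeMinimal.planeExample z X Y =
            3 * Real.exp (z 0) * ((X 0 * Y 1 + X 1 * Y 0) / 2) ∧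
          TimelikeMinimal.firstForm TimelikeMinimal.scrollExample z X Y =
            3 * Real.exp (z 0) * ((X 0 * Y 1 + X 1 * Y 0) / 2) := fun z X Y => by
      rw [TimelikeMinimal.planeExample_eq, TimelikeMinimal.scrollExample_eq]
      exact ⟨hp.firstForm_eq z X Y, hb.firstForm_eq z X Y⟩
    refine ⟨⟨?_, ?_⟩, fun z => ⟨?_, ?_⟩,
      ⟨TimelikeMinimal.liesInTimelikePlane_planeExample, fun z => ?_⟩,
      ⟨TimelikeMinimal.isBScroll_scrollExample, fun z => ?_⟩, hI, fun z X Y => ?_, ?_,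
      fun F hF θ => TimelikeMinimal.not_congruent_scrollExample hF θ⟩
    · rw [TimelikeMinimal.planeExample_eq]; exact hp.isTimelikeMinimal
    · rw [TimelikeMinimal.scrollExample_eq]; exact hb.isTimelikeMinimal
    · rw [TimelikeMinimal.planeExample_eq]; exact hp.isFlatPoint z
    · rw [TimelikeMinimal.scrollExample_eq]; exact hb.isFlatPoint z
    · rw [TimelikeMinimal.planeExample_eq]; exact hp.isUmbilic rfl
    · rw [TimelikeMinimal.scrollExample_eq]; exact hb.isQuasiUmbilic (by positivity)
    · rw [Diffeomorph.coe_refl, mfderiv_id]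
      exact (hI z X Y).1.trans (hI z X Y).2.symm
    · rw [TimelikeMinimal.planeExample_eq]; exact hp.exists_isAssociatedFamily
  · intro M₁ M₂ _ _ _ _ _ _ _ _ _ _ _ _ f₁ f₂ h₁ h₂ _ hflat σ
    have hN := fun p => TimelikeMinimal.isNonflatAt_of_not_isFlatPoint h₂ (hflat p)
    obtain ⟨Ψ₀, J₀, h₀⟩ := TimelikeMinimal.exists_isLift h₂
    refine ⟨fun hσ => ⟨h₀.exists_isAssociatedFamily, fun F hF => ?_⟩, fun hσ =>
      ⟨⟨_, _, h₀.isParaholomorphicLift, rfl⟩, fun g hg => ?_⟩⟩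
    · obtain ⟨Ψ, J, h, hFθ⟩ := hF.exists_isLift
      simp only [hFθ]
      exact TimelikeMinimal.exists_congruentVia h₁ h h₂.1 hN hσ
    · obtain ⟨J, h⟩ := hg.exists_isLift
      refine ⟨h.conj.exists_isAssociatedFamily, fun F hF => ?_⟩
      obtain ⟨Ψ', J', h', hFθ⟩ := hF.exists_isLift
      simp only [hFθ]
      exact TimelikeMinimal.exists_congruentVia h₁ h' (h.isTimelike_im h₂.1)
        (fun p => h.isNonflatAt_im (hN p)) fun p X Y => by rw [h.firstForm_im]; exact hσ p X Y
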